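/- Let $\mathcal X,\mathcal Y,\mathcal A,\mathcal B$ be nonempty finite sets, let $p_{XY}$ be a probability distribution on $\mathcal X\times\mathcal Y$, and let $u:\mathcal A\times\mathcal B\to\mathbb R$ be a payoff matrix. Let $(X_t,Y_t)$, $t=1,2,\dots$, be i.i.d. with law $p_{XY}$. In the infinitely repeated zero-sum game with leaked randomness source, at each stage $t$ Alice privately observes $X_t$, Bob privately observes $Y_t$, they then choose actions $A_t\in\mathcal A$ and $B_t\in\mathcal B$, both actions become known to both players, and Alice receives the payoff $u_{A_t,B_t}$ from Bob. A strategy of Alice is a sequence $\sigma=(\sigma_t)_{t\ge1}$ of deterministic functions $\sigma_t:(\mathcal A\times\mathcal B)^{t-1}\times\mathcal X^t\to\mathcal A$, with $A_t=\sigma_t(A_1,B_1,\dots,A_{t-1},B_{t-1},X_1,\dots,X_t)$. A strategy of Bob is a sequence $\tau=(\tau_t)_{t\ge1}$ of random functions $\tau_t:(\mathcal A\times\mathcal B)^{t-1}\times\mathcal Y^t\to\mathcal B$: given the past, $B_t$ is drawn from a probability distribution on $\mathcal B$ that depends on $(A_1,B_1,\dots,A_{t-1},B_{t-1},Y_1,\dots,Y_t)$.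 Let $$\lambda_T(\sigma,\tau)=\mathbb E_{\sigma,\tau}\Big[\frac1T\sum_{t=1}^T u_{A_t,B_t}\Big].$$ Alice can secure $v\in\mathbb R$ if there is a strategy $\sigma^*$ such that $\liminf_{T\to\infty}\lambda_T(\sigma^*,\tau)\ge v$ for every strategy $\tau$ of Bob; Bob can defend $v$ if for every strategy $\sigma$ of Alice there is a strategy $\tau^*$ with $\limsup_{T\to\infty}\lambda_T(\sigma,\tau^*)\le v$; and $v$ is the maxmin value of the game if Alice can secure $v$ and Bob can defend $v$. For $h\ge0$ let $$\mathcal J(h)=\max_{\mathbf p\in\Delta(\mathcal A),\ H(\mathbf p)\le h}\ \min_{b\in\mathcal B}\ \sum_{a\in\mathcal A}\mathbf p(a)\,u_{a,b},$$ where $\Delta(\mathcal A)$ is the set of probability distributions on $\mathcal A$ and $H(\mathbf p)=-\sum_a\mathbf p(a)\log_2\mathbf p(a)$ (with $0\log_20=0$), and let $\mathcal J_{\mathrm{cav}}$ be the upper concave envelope of $\mathcal J$ on $[0,\infty)$, i.e. the smallest concave function on $[0,\infty)$ that is at least $\mathcal J$. Let $H(X|Y)=-\sum_{x,y}p_{XY}(x,y)\log_2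 p_{X|Y}(x|y)$. Then the maxmin value of the repeated game with leaked randomness source is $\mathcal J_{\mathrm{cav}}(H(X|Y))$. -/

import Mathlib

open Filter

namespace LeakedGame

noncomputable section

/-- Shannon entropy, in bits, of a probability vector on a finite set
(`0 * logb 2 0 = 0`). -/
def entropy {A : Type*} [Fintype A] (q : A → ℝ) : ℝ :=
  ∑ a, -(q a * Real.logb 2 (q a))

/-- Conditional Shannon entropy `H(X|Y)`, in bits, of a joint probability vector `p` on `X × Y`:
the sum of `-p(x,y) * log₂ p(x|y)`, where `p(x|y) = p(x,y) / p_Y(y)`.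
(Where `p_Y(y) = 0`, also `p(x,y) = 0` and the summand vanishes.) -/
def condEntropy {X Y : Type*} [Fintype X] [Fintype Y] (p : X × Y → ℝ) : ℝ :=
  ∑ x, ∑ y, -(p (x, y) * Real.logb 2 (p (x, y) / ∑ x', p (x', y)))

/-- The payoff that the mixed action `q` guarantees to Alice in the one-shot game with payoff
matrix `u`: the minimum over Bob's actions `b` of the expectation of `u A b`, `A` of law `q`. -/
def securityLevel {A B : Type*} [Fintype A] (u : A → B → ℝ) (q : A → ℝ) : ℝ :=
  ⨅ b, ∑ a, q a * u a b

/-- `J(h)`: the best payoff that Alice can secure in the one-shot game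
with a mixed action of entropy at most `h`. -/
def J {A B : Type*} [Fintype A] (u : A → B → ℝ) (h : ℝ) : ℝ :=
  sSup (securityLevel u '' {q | q ∈ stdSimplex ℝ A ∧ entropy q ≤ h})

/-- The upper concave envelope, on `[0, ∞)`, of a function `f`:
the pointwise infimum of all concave functions on `[0, ∞)` that are at least `f` there. -/
def concaveEnvelope (f : ℝ → ℝ) (h : ℝ) : ℝ :=
  sInf {r | ∃ g : ℝ → ℝ, ConcaveOn ℝ (Set.Ici 0) g ∧ (∀ s ∈ Set.Ici (0 : ℝ), f s ≤ g s) ∧ r = g h}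

/-- A strategy of Alice. Stages are numbered `0, 1, 2, …`. At stage `t` she knows the actions of
both players at the stages before `t` and the source symbols of the stages up to and including `t`,
and she chooses her action as a deterministic function of these. -/
abbrev AliceStrategy (X A B : Type*) :=
  (t : ℕ) → (Fin t → A × B) → (Fin (t + 1) → X) → A

/-- A strategy of Bob. At stage `t` he knows the actions of both players at the stages before `t`
and the leaked symbols of the stages up to and including `t`, and he chooses his action at random,
with a law that depends on these. -/
abbrev BobStrategy (Y A B : Type*) [Fintype B] :=
  (t : ℕ) → (Fin t → A × B) → (Fin (t + 1) → Y) → stdSimplex ℝ B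

/-- The pairs of actions played before stage `t`. -/
def pastActions {A B : Type*} {T : ℕ} (a : Fin T → A) (b : Fin T → B) (t : Fin T) :
    Fin (t : ℕ) → A × B :=
  fun i => (a (Fin.castLE t.is_lt.le i), b (Fin.castLE t.is_lt.le i))

/-- The symbols of a sequence up to and including stage `t`. -/
def upTo {X : Type*} {T : ℕ} (x : Fin T → X) (t : Fin T) : Fin ((t : ℕ) + 1) → X :=
  fun i => x (Fin.castLE (Nat.succ_le_of_lt t.is_lt) i)

/-- The probability that the first `T` stages produce the source symbols `x`, the leaked symbols
`y` and the actions `a` and `b`, when the pairs `(x t, y t)` are drawn i.i.d. from `p`, Alice plays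
`σ` and Bob plays `τ`. -/
def playProb {X Y A B : Type*} [DecidableEq A] [Fintype B]
    (p : X × Y → ℝ) (σ : AliceStrategy X A B) (τ : BobStrategy Y A B) {T : ℕ}
    (x : Fin T → X) (y : Fin T → Y) (a : Fin T → A) (b : Fin T → B) : ℝ :=
  ∏ t : Fin T,
    p (x t, y t)
      * (if a t = σ t (pastActions a b t) (upTo x t) then 1 else 0)
      * (τ t (pastActions a b t) (upTo y t)).1 (b t)

/-- `λ_T(σ, τ)`: the expected average payoff of Alice over the first `T` stages. -/
def avgPayoff {X Y A B : Type*} [Fintype X] [Fintype Y] [Fintype A] [DecidableEq A] [Fintype B]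
    (p : X × Y → ℝ) (u : A → B → ℝ) (σ : AliceStrategy X A B) (τ : BobStrategy Y A B)
    (T : ℕ) : ℝ :=
  ∑ x : Fin T → X, ∑ y : Fin T → Y, ∑ a : Fin T → A, ∑ b : Fin T → B,
    playProb p σ τ x y a b * ((1 / (T : ℝ)) * ∑ t, u (a t) (b t))

/-- Alice can secure `v`. -/
def AliceCanSecure {X Y A B : Type*} [Fintype X] [Fintype Y] [Fintype A] [DecidableEq A]
    [Fintype B] (p : X × Y → ℝ) (u : A → B → ℝ) (v : ℝ) : Prop :=
  ∃ σ : AliceStrategy X A B, ∀ τ : BobStrategy Y A B,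
    v ≤ liminf (fun T => avgPayoff p u σ τ T) atTop

/-- Bob can defend `v`. -/
def BobCanDefend {X Y A B : Type*} [Fintype X] [Fintype Y] [Fintype A] [DecidableEq A]
    [Fintype B] (p : X × Y → ℝ) (u : A → B → ℝ) (v : ℝ) : Prop :=
  ∀ σ : AliceStrategy X A B, ∃ τ : BobStrategy Y A B,
    limsup (fun T => avgPayoff p u σ τ T) atTop ≤ v

/-- `v` is the maxmin value of the repeated game with leaked randomness source. -/
def IsMaxminValue {X Y A B : Type*} [Fintype X] [Fintype Y] [Fintype A] [DecidableEq A]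
    [Fintype B] (p : X × Y → ℝ) (u : A → B → ℝ) (v : ℝ) : Prop :=
  AliceCanSecure p u v ∧ BobCanDefend p u v

end

end LeakedGame

/-! Bob cannot be surprised by more randomness than the source provides. Against a known `σ` he
plays a best reply to the conditional law of Alice's next action given what he has observed. If that
law has entropy `h`, the stage gives Alice at most `J u h`. By the chain rule
(`residualEntropy_succ_add`) the expected conditional entropies of the first `T` actions add up to
at most `T * condEntropy p`. Jensen's inequality for any concave majorant of `J u`, applied within a
stage (`stagePayoff_le`) and then over stages, gives `bobCanDefend`.

Conversely, Alice can spend almost all of this entropy. Time sharing realises every value below the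
envelope by a sequence of mixed actions whose entropy rate is strictly below `H(X|Y)`
(`exists_achievable_of_lt_concaveEnvelope`); if `H(X|Y) = 0`, a pure action suffices. At such a rate
a random map turns a long block of source symbols into actions that have nearly the prescribed
product law and are nearly independent of the leaked block (`eventually_exists_extractionError_le`).
Alice plays in each block the actions extracted from the previous one, so Bob has already seen all
the relevant leakage and still faces a nearly fresh mixed action at every stage
(`securityLevel_sub_le_stagePayoff`). Blocks lie between consecutive squares: their lengths tend to
infinity, yet an unfinished block is negligible in the average. Nearly optimal plans in all blocks
form one strategy that secures the envelope itself. -/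

namespace LeakedGame

/-! ### Product weights on finite products -/

section ProductWeights

variable {ι κ S : Type*} [Fintype ι] [Fintype κ] [Fintype S]

lemma sum_prod_weight [DecidableEq ι] {w : ι → S → ℝ} (hw : ∀ i, ∑ s, w i s = 1) :
    ∑ z : ι → S, ∏ i, w i (z i) = 1 := by
  rw [← Fintype.prod_sum]
  simp [hw]

/-- Overwriting the coordinates in the range of `e` by an independent copy does not change the
law of a family of independent variables. -/
lemma sum_prod_weight_resample [DecidableEq ι] [DecidableEq κ] {w : ι → S → ℝ}
    (hw : ∀ i, ∑ s, w i s = 1) {e : κ → ι} (he : Function.Injective e) (F : (ι → S) → ℝ) :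
    ∑ z : ι → S, (∏ i, w i (z i)) * F z =
      ∑ z : ι → S, (∏ i, w i (z i)) *
        ∑ v : κ → S, (∏ j, w (e j) (v j)) * F (Function.extend e v z) := by
  have hmass : ∀ (z : ι → S) (v : κ → S), (∏ i, w i (z i)) * ∏ j, w (e j) (v j) =
      (∏ i, w i (Function.extend e v z i)) * ∏ j, w (e j) (z (e j)) := by
    intro z v
    have key : ∀ z : ι → S, ∏ i, w i (z i) =
        (∏ j, w (e j) (z (e j))) * ∏ i ∈ (Finset.univ.map ⟨e, he⟩)ᶜ, w i (z i) := by
      intro z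
      rw [← Finset.prod_mul_prod_compl (Finset.univ.map ⟨e, he⟩), Finset.prod_map]
      rfl
    rw [key z, key (Function.extend e v z)]
    have h1 : ∏ i ∈ (Finset.univ.map ⟨e, he⟩)ᶜ, w i (Function.extend e v z i) =
        ∏ i ∈ (Finset.univ.map ⟨e, he⟩)ᶜ, w i (z i) := by
      refine Finset.prod_congr rfl fun i hi => ?_
      rw [Function.extend_apply']
      rintro ⟨j, rfl⟩
      simp at hi
    rw [h1]
    simp only [he.extend_apply]
    ring
  -- Exchanging `v` with the coordinates of `z` along `e` is an involution of the pairs that, by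
  -- `hmass`, preserves the product weight.
  have hinv : Function.Involutive
      (fun q : (ι → S) × (κ → S) => ((Function.extend e q.2 q.1, q.1 ∘ e) : (ι → S) × (κ → S))) := by
    rintro ⟨z, v⟩
    refine Prod.ext ?_ ?_
    · funext i
      by_cases h : ∃ j, e j = i
      · obtain ⟨j, rfl⟩ := h
        simp [he.extend_apply]
      · simp [Function.extend_apply' _ _ _ h]
    · funext j
      simp [he.extend_apply]
  have h2 : ∑ q : (ι → S) × (κ → S), (∏ i, w i (q.1 i)) * (∏ j, w (e j) (q.2 j)) *
        F (Function.extend e q.2 q.1) =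
      ∑ q : (ι → S) × (κ → S), (∏ i, w i (q.1 i)) * (∏ j, w (e j) (q.2 j)) * F q.1 :=
    Fintype.sum_equiv hinv.toPerm _ _ fun q => by
      rw [hmass]
      rfl
  rw [Fintype.sum_prod_type, Fintype.sum_prod_type] at h2
  simp only [Finset.mul_sum, ← mul_assoc]
  rw [h2]
  refine Finset.sum_congr rfl fun z _ => ?_
  simp only
  rw [← Finset.sum_mul, ← Finset.mul_sum, sum_prod_weight fun j => hw (e j), mul_one]

/-- Resampling a single coordinate amounts to integrating it out first. -/
lemma sum_prod_weight_update [DecidableEq ι] {w : ι → S → ℝ}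
    (hw : ∀ i, ∑ s, w i s = 1) (i : ι) (F : (ι → S) → ℝ) :
    ∑ z : ι → S, (∏ i, w i (z i)) * F z =
      ∑ z : ι → S, (∏ i, w i (z i)) * ∑ s, w i s * F (Function.update z i s) := by
  rw [sum_prod_weight_resample hw (e := fun _ : Unit => i) (fun _ _ _ => rfl) F]
  refine Finset.sum_congr rfl fun z _ => ?_
  congr 1
  refine Fintype.sum_equiv (Equiv.funUnique Unit S) _ _ fun v => ?_
  congr 1
  · simp
  · congr 1
    funext k
    by_cases h : k = i
    · subst h
      have := (show Function.Injective (fun _ : Unit => k) from fun _ _ _ => rfl).extend_apply v z ()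
      simpa using this
    · rw [Function.extend_apply' _ _ _ (by simpa using fun h' => h h'.symm)]
      simp [h]

/-- The variance of a sum of independent centred variables is the sum of the variances. -/
lemma sum_prod_weight_mul_sq [DecidableEq ι] {w : ι → S → ℝ} (hw : ∀ i, ∑ s, w i s = 1)
    {g : ι → S → ℝ} (hg : ∀ i, ∑ s, w i s * g i s = 0) :
    ∑ z : ι → S, (∏ i, w i (z i)) * (∑ i, g i (z i)) ^ 2 = ∑ i, ∑ s, w i s * g i s ^ 2 := by
  simp only [sq, Finset.sum_mul, Finset.mul_sum]
  rw [Finset.sum_comm]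
  refine Finset.sum_congr rfl fun i _ => ?_
  rw [Finset.sum_comm, Finset.sum_eq_single i]
  · rw [sum_prod_weight_update hw i]
    simp only [Function.update_self]
    rw [← Finset.sum_mul, sum_prod_weight hw, one_mul]
  · intro j _ hj
    rw [sum_prod_weight_update hw i]
    refine Finset.sum_eq_zero fun z _ => ?_
    simp only [Function.update_self, Function.update_of_ne hj,
      mul_comm (g j _), ← mul_assoc]
    rw [← Finset.sum_mul, hg, zero_mul, mul_zero]
  · simp

/-- Chebyshev's inequality for sums of independent variables. -/
lemma chebyshev_prod_weight [DecidableEq ι] {w : ι → S → ℝ} (hw0 : ∀ i s, 0 ≤ w i s)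
    (hw : ∀ i, ∑ s, w i s = 1) (g : ι → S → ℝ) {V d : ℝ} (hV : ∀ i, ∑ s, w i s * g i s ^ 2 ≤ V)
    (hd : 0 < d) :
    ∑ z : ι → S, (∏ i, w i (z i)) *
      (if ∑ i, g i (z i) ≤ (∑ i, ∑ s, w i s * g i s) + d then 0 else 1) ≤
        Fintype.card ι * V / d ^ 2 := by
  set m : ι → ℝ := fun i => ∑ s, w i s * g i s with hm
  have hg : ∀ i, ∑ s, w i s * (g i s - m i) = 0 := by
    intro i
    simp only [mul_sub, Finset.sum_sub_distrib, ← Finset.sum_mul, hw, one_mul]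
    simp [hm]
  have h2 := sum_prod_weight_mul_sq hw hg
  -- A variance is at most the second moment.
  have h3 : ∀ i, ∑ s, w i s * (g i s - m i) ^ 2 ≤ V := by
    intro i
    have : ∑ s, w i s * (g i s - m i) ^ 2 = ∑ s, w i s * g i s ^ 2 - m i ^ 2 := by
      have : ∀ s, w i s * (g i s - m i) ^ 2 =
          w i s * g i s ^ 2 - 2 * m i * (w i s * g i s) + m i ^ 2 * w i s := fun s => by ring
      simp only [this, Finset.sum_add_distrib, Finset.sum_sub_distrib, ← Finset.mul_sum, hw]
      change _ - 2 * m i * m i + m i ^ 2 * 1 = _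
      ring
    rw [this]
    have := hV i
    nlinarith [sq_nonneg (m i)]
  rw [le_div_iff₀ (by positivity), Finset.sum_mul]
  calc _ ≤ ∑ z : ι → S, (∏ i, w i (z i)) * (∑ i, (g i (z i) - m i)) ^ 2 := by
        refine Finset.sum_le_sum fun z _ => ?_
        rw [mul_assoc]
        refine mul_le_mul_of_nonneg_left ?_ (Finset.prod_nonneg fun i _ => hw0 _ _)
        split_ifs with h
        · rw [zero_mul]; positivity
        · rw [one_mul, Finset.sum_sub_distrib]
          push Not at h
          nlinarith
    _ ≤ ∑ i : ι, V := by
        rw [h2]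
        exact Finset.sum_le_sum fun i _ => h3 i
    _ = _ := by simp

end ProductWeights

/-! ### Extracting nearly independent actions from a source -/

section RandomMap

variable {α β γ : Type*} [Fintype α] [Fintype β] [Fintype γ] [DecidableEq α] [DecidableEq γ]

/-- The weight `∏ i, Q (f i)` is the law of a random map `f` with independent values of law `Q`. -/
lemma sum_indicator_prod_weight {Q : γ → ℝ} (hQ1 : ∑ a, Q a = 1) (x : α) (a : γ) :
    ∑ f : α → γ, (∏ i, Q (f i)) * (if f x = a then 1 else 0) = Q a := by
  rw [sum_prod_weight_update (w := fun _ => Q) (fun _ => hQ1) x]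
  simp only [Function.update_self, mul_ite, mul_one, mul_zero, Finset.sum_ite_eq',
    Finset.mem_univ, if_true]
  rw [← Finset.sum_mul, sum_prod_weight fun _ => hQ1, one_mul]

/-- The triangle inequality alone; this crude bound serves for the atypical source words and
actions. -/
lemma sum_weight_abs_le_two_mul {Q : γ → ℝ} (hQ0 : ∀ a, 0 ≤ Q a) (hQ1 : ∑ a, Q a = 1) {c : α → ℝ}
    (hc : ∀ x, 0 ≤ c x) (a : γ) :
    ∑ f : α → γ, (∏ i, Q (f i)) * |∑ x, c x * ((if f x = a then 1 else 0) - Q a)| ≤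
      2 * Q a * ∑ x, c x := by
  calc _ ≤ ∑ f : α → γ, (∏ i, Q (f i)) * ∑ x, c x * ((if f x = a then 1 else 0) + Q a) := by
        refine Finset.sum_le_sum fun f _ =>
          mul_le_mul_of_nonneg_left ?_ (Finset.prod_nonneg fun i _ => hQ0 _)
        refine (Finset.abs_sum_le_sum_abs _ _).trans (Finset.sum_le_sum fun x _ => ?_)
        rw [abs_mul, abs_of_nonneg (hc x)]
        refine mul_le_mul_of_nonneg_left ((abs_sub _ _).trans ?_) (hc x)
        rw [abs_of_nonneg (hQ0 a), abs_of_nonneg (by split_ifs <;> norm_num)]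
    _ = ∑ x, c x * (∑ f : α → γ, (∏ i, Q (f i)) * (if f x = a then 1 else 0) +
          (∑ f : α → γ, ∏ i, Q (f i)) * Q a) := by
        simp only [Finset.mul_sum, Finset.sum_mul, mul_add, Finset.sum_add_distrib]
        congr 1 <;>
        · rw [Finset.sum_comm]
          exact Finset.sum_congr rfl fun x _ => Finset.sum_congr rfl fun f _ => by ring
    _ = _ := by
        rw [sum_prod_weight fun _ => hQ1]
        simp only [sum_indicator_prod_weight hQ1]
        rw [← Finset.sum_mul]
        ring

/-- Cauchy–Schwarz reduces this to the variance of a sum of independent terms, and the indicator of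
`a` has variance at most `Q a`. It improves on the crude bound when the mass `c` is spread over many
points. -/
lemma sum_weight_abs_le_sqrt {Q : γ → ℝ} (hQ0 : ∀ a, 0 ≤ Q a) (hQ1 : ∑ a, Q a = 1) (c : α → ℝ)
    (a : γ) :
    ∑ f : α → γ, (∏ i, Q (f i)) * |∑ x, c x * ((if f x = a then 1 else 0) - Q a)| ≤
      √((∑ x, c x ^ 2) * Q a) := by
  have hω : ∀ f : α → γ, 0 ≤ ∏ i, Q (f i) := fun f => Finset.prod_nonneg fun i _ => hQ0 _
  refine Real.le_sqrt_of_sq_le ?_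
  refine (Finset.sum_sq_le_sum_mul_sum_of_sq_le_mul Finset.univ (f := fun f : α → γ => ∏ i, Q (f i))
    (g := fun f => (∏ i, Q (f i)) * (∑ x, c x * ((if f x = a then 1 else 0) - Q a)) ^ 2)
    (fun f _ => hω f) (fun f _ => mul_nonneg (hω f) (sq_nonneg _)) fun f _ => ?_).trans ?_
  · rw [mul_pow, sq_abs]; exact le_of_eq (by ring)
  · have hind : ∑ s, Q s * (if s = a then (1 : ℝ) else 0) = Q a := by simp
    rw [sum_prod_weight fun _ => hQ1, one_mul,
      sum_prod_weight_mul_sq (w := fun _ => Q)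
        (g := fun x s => c x * ((if s = a then 1 else 0) - Q a)) (fun _ => hQ1), Finset.sum_mul]
    · refine Finset.sum_le_sum fun x _ => ?_
      have h : ∀ s, Q s * (c x * ((if s = a then 1 else 0) - Q a)) ^ 2 =
          c x ^ 2 * ((1 - 2 * Q a) * (Q s * (if s = a then 1 else 0)) + Q a ^ 2 * Q s) := by
        intro s
        split_ifs <;> ring
      simp only [h, ← Finset.mul_sum, Finset.sum_add_distrib, hind, hQ1]
      refine mul_le_mul_of_nonneg_left ?_ (sq_nonneg _)
      nlinarith [sq_nonneg (Q a)]
    · intro x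
      have h : ∀ s, Q s * (c x * ((if s = a then 1 else 0) - Q a)) =
          c x * (Q s * (if s = a then 1 else 0) - Q a * Q s) := fun s => by ring
      simp only [h, ← Finset.mul_sum, Finset.sum_sub_distrib, hind, hQ1]
      ring

/-- A random map `f` turns the source `x` into an action `f x` of law nearly `Q` and nearly
independent of the leaked symbol `y`, provided that `x` is hard to guess given `y`. -/
lemma exists_map_sum_abs_le {P : α → β → ℝ} (hP0 : ∀ x y, 0 ≤ P x y)
    (hP1 : ∑ y, ∑ x, P x y = 1) {Q : γ → ℝ} (hQ0 : ∀ a, 0 ≤ Q a) (hQ1 : ∑ a, Q a = 1)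
    (G : α → β → Prop) [∀ x y, Decidable (G x y)] (E : γ → Prop) [DecidablePred E] {m K : ℝ}
    (hm0 : 0 ≤ m) (hm : ∀ x y, G x y → P x y ≤ m * ∑ x', P x' y)
    (hK : ∀ a, E a → 1 ≤ K * Q a) :
    ∃ f : α → γ,
      ∑ y, ∑ a, |∑ x, P x y * (if f x = a then 1 else 0) - (∑ x, P x y) * Q a| ≤
        2 * ∑ y, ∑ x, P x y * (if G x y then 0 else 1) +
          2 * ∑ a, Q a * (if E a then 0 else 1) + √(m * K) := by
  have hω : ∀ f : α → γ, 0 ≤ ∏ i, Q (f i) := fun f => Finset.prod_nonneg fun i _ => hQ0 _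
  have hω1 : ∑ f : α → γ, ∏ i, Q (f i) = 1 := sum_prod_weight fun _ => hQ1
  have core : ∀ y a, ∑ f : α → γ, (∏ i, Q (f i)) *
      |∑ x, P x y * (if f x = a then 1 else 0) - (∑ x, P x y) * Q a| ≤
      2 * Q a * (∑ x, P x y * (if G x y then 0 else 1)) +
        2 * (∑ x, P x y) * (Q a * (if E a then 0 else 1)) + √(m * K) * ((∑ x, P x y) * Q a) := by
    intro y a
    have hPY : 0 ≤ ∑ x, P x y := Finset.sum_nonneg fun x _ => hP0 x y
    -- The good part `c` has small atoms and gets the variance bound; the rest `d` gets the crude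
    -- one.
    set c : α → ℝ := fun x => P x y * (if G x y then 1 else 0) with hc
    set d : α → ℝ := fun x => P x y * (if G x y then 0 else 1) with hd
    have hc0 : ∀ x, 0 ≤ c x := fun x => mul_nonneg (hP0 x y) (by split_ifs <;> norm_num)
    have hd0 : ∀ x, 0 ≤ d x := fun x => mul_nonneg (hP0 x y) (by split_ifs <;> norm_num)
    have hcd : ∀ x, P x y = c x + d x := fun x => by simp only [hc, hd]; split_ifs <;> ring
    have hcP : ∑ x, c x ≤ ∑ x, P x y :=
      Finset.sum_le_sum fun x _ => by rw [hcd x]; linarith [hd0 x]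
    have hsplit : ∀ f : α → γ,
        ∑ x, P x y * (if f x = a then 1 else 0) - (∑ x, P x y) * Q a =
          ∑ x, c x * ((if f x = a then 1 else 0) - Q a) +
            ∑ x, d x * ((if f x = a then 1 else 0) - Q a) := by
      intro f
      rw [Finset.sum_mul, ← Finset.sum_sub_distrib, ← Finset.sum_add_distrib]
      refine Finset.sum_congr rfl fun x _ => ?_
      rw [hcd x]; ring
    have h1 : ∑ f : α → γ, (∏ i, Q (f i)) *
        |∑ x, P x y * (if f x = a then 1 else 0) - (∑ x, P x y) * Q a| ≤
        ∑ f : α → γ, (∏ i, Q (f i)) * |∑ x, c x * ((if f x = a then 1 else 0) - Q a)| +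
        ∑ f : α → γ, (∏ i, Q (f i)) * |∑ x, d x * ((if f x = a then 1 else 0) - Q a)| := by
      rw [← Finset.sum_add_distrib]
      refine Finset.sum_le_sum fun f _ => ?_
      rw [← mul_add, hsplit]
      exact mul_le_mul_of_nonneg_left (abs_add_le _ _) (hω f)
    have h2 := sum_weight_abs_le_two_mul hQ0 hQ1 hd0 a
    have hs : 0 ≤ √(m * K) * ((∑ x, P x y) * Q a) :=
      mul_nonneg (Real.sqrt_nonneg _) (mul_nonneg hPY (hQ0 a))
    by_cases hE : E a
    · have h3 := sum_weight_abs_le_sqrt hQ0 hQ1 c a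
      -- Atoms of `c` are at most `m` times the mass of `y`. The factor `K * Q a ≥ 1` supplies the
      -- missing power of `Q a`, so that the bound can be summed over all `a` without counting them.
      have h4 : √((∑ x, c x ^ 2) * Q a) ≤ √(m * K) * ((∑ x, P x y) * Q a) := by
        refine Real.sqrt_le_iff.2 ⟨hs, ?_⟩
        have hKQ := hK a hE
        have hQa : 0 < Q a := by
          rcases (hQ0 a).eq_or_lt with h | h
          · rw [← h] at hKQ; norm_num at hKQ
          · exact h
        have hK0 : 0 ≤ K := by
          by_contra! h
          nlinarith
        have h5 : ∑ x, c x ^ 2 ≤ m * (∑ x, P x y) ^ 2 := by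
          calc _ ≤ ∑ x, (m * ∑ x, P x y) * c x := by
                refine Finset.sum_le_sum fun x _ => ?_
                rw [sq]
                refine mul_le_mul_of_nonneg_right ?_ (hc0 x)
                by_cases hG : G x y
                · simpa [hc, hG] using hm x y hG
                · simpa [hc, hG] using mul_nonneg hm0 hPY
            _ ≤ _ := by
                rw [← Finset.mul_sum, sq, ← mul_assoc]
                exact mul_le_mul_of_nonneg_left hcP (mul_nonneg hm0 hPY)
        rw [mul_pow, Real.sq_sqrt (mul_nonneg hm0 hK0)]
        calc (∑ x, c x ^ 2) * Q a ≤ m * (∑ x, P x y) ^ 2 * Q a :=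
              mul_le_mul_of_nonneg_right h5 hQa.le
          _ ≤ m * (∑ x, P x y) ^ 2 * Q a * (K * Q a) :=
              le_mul_of_one_le_right (by positivity) hKQ
          _ = _ := by ring
      simp only [hE, if_true, mul_zero, add_zero]
      linarith
    · have h3 := sum_weight_abs_le_two_mul hQ0 hQ1 hc0 a
      have h4 : 2 * Q a * ∑ x, c x ≤ 2 * Q a * ∑ x, P x y :=
        mul_le_mul_of_nonneg_left hcP (by linarith [hQ0 a])
      simp only [hE, if_false, mul_one]
      linarith
  have havg : ∑ f : α → γ, (∏ i, Q (f i)) *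
      ∑ y, ∑ a, |∑ x, P x y * (if f x = a then 1 else 0) - (∑ x, P x y) * Q a| ≤
        2 * ∑ y, ∑ x, P x y * (if G x y then 0 else 1) +
          2 * ∑ a, Q a * (if E a then 0 else 1) + √(m * K) := by
    calc _ = ∑ y, ∑ a, ∑ f : α → γ, (∏ i, Q (f i)) *
          |∑ x, P x y * (if f x = a then 1 else 0) - (∑ x, P x y) * Q a| := by
          simp only [Finset.mul_sum]
          rw [Finset.sum_comm]
          exact Finset.sum_congr rfl fun y _ => Finset.sum_comm
      _ ≤ ∑ y, ∑ a, (2 * Q a * (∑ x, P x y * (if G x y then 0 else 1)) +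
        2 * (∑ x, P x y) * (Q a * (if E a then 0 else 1)) + √(m * K) * ((∑ x, P x y) * Q a)) :=
          Finset.sum_le_sum fun y _ => Finset.sum_le_sum fun a _ => core y a
      _ = _ := by
          simp only [Finset.sum_add_distrib, ← Finset.mul_sum, ← Finset.sum_mul, hQ1, hP1,
            mul_one]
  -- The bound holds on average over the random map, hence for some map.
  by_contra! hlt
  refine absurd havg (not_le.2 ?_)
  obtain ⟨f₀, hf₀⟩ : ∃ f : α → γ, 0 < ∏ i, Q (f i) := by
    by_contra! h
    have := Finset.sum_nonpos fun f (_ : f ∈ Finset.univ) => h f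
    linarith
  have key : ∀ r (F : (α → γ) → ℝ), (∀ f, r < F f) → r < ∑ f, (∏ i, Q (f i)) * F f := by
    intro r F h
    rw [← one_mul r, ← hω1, Finset.sum_mul]
    exact Finset.sum_lt_sum (fun f _ => mul_le_mul_of_nonneg_left (h f).le (hω f))
      ⟨f₀, Finset.mem_univ _, mul_lt_mul_of_pos_left (h f₀) hf₀⟩
  exact key _ _ hlt

end RandomMap

/-! ### Asymptotic extraction from an i.i.d. source -/

section Extraction

variable {X Y A : Type*} [Fintype X] [Fintype Y] [Fintype A]

lemma sum_fun_prod {ι : Type*} [Fintype ι] [DecidableEq ι] (F : (ι → X × Y) → ℝ) :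
    ∑ z, F z = ∑ y : ι → Y, ∑ x : ι → X, F fun i => (x i, y i) := by
  rw [Finset.sum_comm, ← Fintype.sum_prod_type' (fun (x : ι → X) (y : ι → Y) => F fun i => (x i, y i))]
  exact Fintype.sum_equiv (Equiv.arrowProdEquivProdArrow ι (fun _ => X) (fun _ => Y)) _ _ fun z => rfl

lemma le_one_of_mem_stdSimplex {q : A → ℝ} (hq : q ∈ stdSimplex ℝ A) (a : A) : q a ≤ 1 :=
  hq.2 ▸ Finset.single_le_sum (fun b _ => hq.1 b) (Finset.mem_univ a)

/-- From `|√x * log √x| < 1`. It bounds the second moment of the information content uniformly over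
all laws on `A`, so Chebyshev's inequality applies to sequences of varying laws. -/
lemma mul_logb_sq_le {x : ℝ} (h0 : 0 ≤ x) (h1 : x ≤ 1) :
    x * Real.logb 2 x ^ 2 ≤ 4 / Real.log 2 ^ 2 := by
  rcases h0.eq_or_lt with rfl | h0
  · simp; positivity
  · have hs : 0 < √x := Real.sqrt_pos.2 h0
    have h := Real.abs_log_mul_self_lt (√x) hs (Real.sqrt_le_one.2 h1)
    have h2 : (Real.log √x * √x) ^ 2 ≤ 1 := by
      rw [← sq_abs]
      exact pow_le_one₀ (abs_nonneg _) h.le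
    rw [Real.log_sqrt h0.le, mul_pow, Real.sq_sqrt h0.le] at h2
    rw [Real.logb, div_pow, ← mul_div_assoc]
    refine div_le_div_of_nonneg_right ?_ (sq_nonneg _)
    nlinarith

lemma prod_eq_two_rpow_sum_logb {ι : Type*} (s : Finset ι) {r : ι → ℝ} (hr : ∀ i ∈ s, 0 < r i) :
    ∏ i ∈ s, r i = (2 : ℝ) ^ ∑ i ∈ s, Real.logb 2 (r i) := by
  rw [Real.rpow_sum_of_pos two_pos]
  exact Finset.prod_congr rfl fun i hi => (Real.rpow_logb two_pos (by norm_num) (hr i hi)).symm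

/-- The `L¹` distance between the joint law of `f x` and the leaked symbols `y`, when the pairs of
symbols are i.i.d. of law `p`, and the law under which `f x` has independent coordinates of laws
`q j` and is independent of `y`. -/
noncomputable def extractionError [DecidableEq A] (p : X × Y → ℝ) {n m : ℕ} (q : Fin m → A → ℝ)
    (f : (Fin n → X) → Fin m → A) : ℝ :=
  ∑ y : Fin n → Y, ∑ a : Fin m → A,
    |∑ x : Fin n → X, (∏ i, p (x i, y i)) * (if f x = a then 1 else 0) -
      (∑ x : Fin n → X, ∏ i, p (x i, y i)) * ∏ j, q j (a j)|

lemma extractionError_nonneg [DecidableEq A] (p : X × Y → ℝ) {n m : ℕ} (q : Fin m → A → ℝ)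
    (f : (Fin n → X) → Fin m → A) : 0 ≤ extractionError p q f :=
  Finset.sum_nonneg fun _ _ => Finset.sum_nonneg fun _ _ => abs_nonneg _

lemma sum_prod_pair {X Y : Type*} [Fintype X] {p : X × Y → ℝ} {n : ℕ} (y : Fin n → Y) :
    ∑ x : Fin n → X, ∏ i, p (x i, y i) = ∏ i, ∑ x, p (x, y i) := by
  rw [Fintype.prod_sum]

/-- Typical source words have conditional probability at most `m`, about `2 ^ (-n (H - δ))`, and
typical action words have probability at least `1 / K`, about `2 ^ (-n (h + δ))`. Of the gap `4 *
δ`, two typicality margins use `2 * δ`, and the rest makes `m * K` decay. The output is two letters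
longer than the input because each block is two stages longer than the one before. -/
lemma exists_extractionError_le [DecidableEq A] {p : X × Y → ℝ} (hp : p ∈ stdSimplex ℝ (X × Y))
    {q : ℕ → A → ℝ} (hq : ∀ t, q t ∈ stdSimplex ℝ A) {h C δ : ℝ} (hδ : 0 < δ)
    (hh : h + 4 * δ ≤ condEntropy p)
    (hC : ∀ n : ℕ, ∑ t ∈ Finset.range n, entropy (q t) ≤ n * h + C) {n : ℕ} (hn : 0 < n) :
    ∃ f : (Fin n → X) → Fin (n + 2) → A,
      extractionError p (fun i => q i) f ≤
        2 * (∑ z, p z * Real.logb 2 (p z / ∑ x, p (x, z.2)) ^ 2) / δ ^ 2 / n +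
        2 * (Fintype.card A * (4 / Real.log 2 ^ 2)) / δ ^ 2 / n +
          √((2 : ℝ) ^ (2 * (h + δ) + C - 2 * δ * n)) := by
  classical
  set g : X × Y → ℝ := fun z => Real.logb 2 (p z / ∑ x, p (x, z.2)) with hg
  set V₁ := ∑ z, p z * g z ^ 2 with hV₁
  set V₂ := (Fintype.card A : ℝ) * (4 / Real.log 2 ^ 2) with hV₂
  have hV₁0 : 0 ≤ V₁ := Finset.sum_nonneg fun z _ => mul_nonneg (hp.1 z) (sq_nonneg _)
  have hV₂0 : 0 ≤ V₂ := by positivity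
  have hmean : ∑ z, p z * g z = -condEntropy p := by
    rw [condEntropy, Fintype.sum_prod_type]
    simp only [Finset.sum_neg_distrib, neg_neg, hg]
  have hn' : (0 : ℝ) < n := by exact_mod_cast hn
  have hcheb₁ := chebyshev_prod_weight (ι := Fin n) (w := fun _ => p) (fun _ z => hp.1 z)
    (fun _ => hp.2) (fun _ => g) (V := V₁) (d := n * δ) (fun _ => le_rfl) (by positivity)
  have hcheb₂ := chebyshev_prod_weight (ι := Fin (n + 2)) (w := fun i : Fin (n + 2) => q i)
    (fun i a => (hq i).1 a) (fun i => (hq i).2) (fun i a => -Real.logb 2 (q i a)) (V := V₂)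
    (d := ((n + 2 : ℕ) : ℝ) * δ)
    (fun i => by
      rw [hV₂, ← nsmul_eq_mul, ← Finset.card_univ, ← Finset.sum_const]
      refine Finset.sum_le_sum fun a _ => ?_
      rw [neg_sq]
      exact mul_logb_sq_le ((hq i).1 a) (le_one_of_mem_stdSimplex (hq i) a)) (by positivity)
  simp only [Fintype.card_fin] at hcheb₁ hcheb₂
  have hsumE : ∑ i : Fin (n + 2), ∑ a, q i a * -Real.logb 2 (q i a) ≤
      ((n + 2 : ℕ) : ℝ) * h + C := by
    refine le_trans (le_of_eq ?_) (hC (n + 2))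
    rw [Finset.sum_range]
    simp only [entropy, mul_neg]
  set K : ℝ := (2 : ℝ) ^ (((n + 2 : ℕ) : ℝ) * h + C + ((n + 2 : ℕ) : ℝ) * δ) with hKdef
  set m : ℝ := (2 : ℝ) ^ (-(n : ℝ) * condEntropy p + n * δ) with hmdef
  have hp0 : ∀ (x : Fin n → X) (y : Fin n → Y), 0 ≤ ∏ i, p (x i, y i) :=
    fun x y => Finset.prod_nonneg fun i _ => hp.1 _
  obtain ⟨f, hf⟩ := exists_map_sum_abs_le (α := Fin n → X) (β := Fin n → Y) (γ := Fin (n + 2) → A)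
    (P := fun x y => ∏ i, p (x i, y i)) hp0
    (by
      rw [← sum_fun_prod fun z => ∏ i, p (z i)]
      exact sum_prod_weight (w := fun _ => p) fun _ => hp.2)
    (Q := fun a => ∏ j : Fin (n + 2), q j (a j)) (fun a => Finset.prod_nonneg fun i _ => (hq i).1 _)
    (sum_prod_weight (w := fun i : Fin (n + 2) => q i) fun i => (hq i).2)
    (fun x y => ∑ i, g (x i, y i) ≤ ∑ _i : Fin n, ∑ z, p z * g z + n * δ)
    -- Since `Real.logb 2 0 = 0`, a word of probability zero could pass for typical. Excluding such
    -- words costs no mass.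
    (fun a => (0 < ∏ j : Fin (n + 2), q j (a j)) ∧ ∑ i : Fin (n + 2), -Real.logb 2 (q i (a i)) ≤
      ∑ i : Fin (n + 2), ∑ a, q i a * -Real.logb 2 (q i a) + ((n + 2 : ℕ) : ℝ) * δ)
    (m := m) (K := K) (by positivity)
    (by
      intro x y hG
      rw [sum_prod_pair]
      by_cases h0 : ∀ i, 0 < p (x i, y i)
      · have hY : ∀ i, 0 < ∑ x, p (x, y i) := fun i =>
          (h0 i).trans_le (Finset.single_le_sum (f := fun x => p (x, y i)) (fun x _ => hp.1 _)
            (Finset.mem_univ _))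
        have h1 : ∏ i, p (x i, y i) =
            (∏ i, p (x i, y i) / ∑ x, p (x, y i)) * ∏ i, ∑ x, p (x, y i) := by
          rw [← Finset.prod_mul_distrib]
          exact Finset.prod_congr rfl fun i _ => (div_mul_cancel₀ _ (hY i).ne').symm
        rw [h1]
        refine mul_le_mul_of_nonneg_right ?_ (Finset.prod_nonneg fun i _ => (hY i).le)
        rw [prod_eq_two_rpow_sum_logb _ fun i _ => div_pos (h0 i) (hY i), hmdef]
        refine Real.rpow_le_rpow_of_exponent_le (by norm_num) (hG.trans (le_of_eq ?_))
        simp only [hmean, Finset.sum_const, Finset.card_univ, Fintype.card_fin, nsmul_eq_mul]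
        ring
      · push Not at h0
        obtain ⟨i, hi⟩ := h0
        rw [Finset.prod_eq_zero (Finset.mem_univ i) (le_antisymm hi (hp.1 _))]
        exact mul_nonneg (by positivity)
          (Finset.prod_nonneg fun i _ => Finset.sum_nonneg fun x _ => hp.1 _))
    (by
      rintro a ⟨ha0, ha⟩
      have ha1 : ∀ j : Fin (n + 2), 0 < q j (a j) := fun j =>
        ((hq j).1 _).lt_of_ne' fun h0 =>
          ha0.ne' (Finset.prod_eq_zero (Finset.mem_univ j) h0)
      rw [prod_eq_two_rpow_sum_logb _ fun i _ => ha1 i, hKdef, ← Real.rpow_add two_pos]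
      refine Real.one_le_rpow (by norm_num) ?_
      rw [Finset.sum_neg_distrib] at ha
      linarith)
  refine ⟨f, hf.trans ?_⟩
  refine add_le_add (add_le_add ?_ ?_) (Real.sqrt_le_sqrt ?_)
  · rw [sum_fun_prod] at hcheb₁
    refine (mul_le_mul_of_nonneg_left hcheb₁ zero_le_two).trans (le_of_eq ?_)
    field_simp
  · have h1 : ∀ a : Fin (n + 2) → A, (∏ j : Fin (n + 2), q j (a j)) * (if (0 < ∏ j : Fin (n + 2), q j (a j)) ∧
        ∑ i : Fin (n + 2), -Real.logb 2 (q i (a i)) ≤ ∑ i : Fin (n + 2),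
          ∑ a, q i a * -Real.logb 2 (q i a) + ((n + 2 : ℕ) : ℝ) * δ then 0 else 1) =
        (∏ j : Fin (n + 2), q j (a j)) * (if ∑ i : Fin (n + 2), -Real.logb 2 (q i (a i)) ≤ ∑ i : Fin (n + 2),
          ∑ a, q i a * -Real.logb 2 (q i a) + ((n + 2 : ℕ) : ℝ) * δ then 0 else 1) := by
      intro a
      have h0 : 0 ≤ ∏ j : Fin (n + 2), q j (a j) := Finset.prod_nonneg fun i _ => (hq i).1 _
      rcases h0.eq_or_lt with h0 | h0
      · rw [← h0]; simp
      · simp only [h0, true_and]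
    simp only [h1]
    refine (mul_le_mul_of_nonneg_left hcheb₂ zero_le_two).trans ?_
    have h2 : 2 * (((n + 2 : ℕ) : ℝ) * V₂ / (((n + 2 : ℕ) : ℝ) * δ) ^ 2) =
        2 * V₂ / δ ^ 2 / ((n + 2 : ℕ) : ℝ) := by
      field_simp
    rw [h2]
    refine div_le_div_of_nonneg_left (by positivity) hn' ?_
    push_cast
    linarith
  · rw [hKdef, hmdef, ← Real.rpow_add two_pos]
    refine Real.rpow_le_rpow_of_exponent_le (by norm_num) ?_
    push_cast
    nlinarith

lemma eventually_exists_extractionError_le [DecidableEq A] {p : X × Y → ℝ}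
    (hp : p ∈ stdSimplex ℝ (X × Y)) {q : ℕ → A → ℝ} (hq : ∀ t, q t ∈ stdSimplex ℝ A) {h C : ℝ}
    (hh : h < condEntropy p)
    (hC : ∀ n : ℕ, ∑ t ∈ Finset.range n, entropy (q t) ≤ n * h + C) {ε : ℝ} (hε : 0 < ε) :
    ∀ᶠ n : ℕ in atTop, ∃ f : (Fin n → X) → Fin (n + 2) → A,
      extractionError p (fun i => q i) f ≤ ε := by
  set δ := (condEntropy p - h) / 4 with hδ
  have hδ0 : 0 < δ := by rw [hδ]; linarith
  have hlim : Tendsto (fun n : ℕ =>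
      2 * (∑ z, p z * Real.logb 2 (p z / ∑ x, p (x, z.2)) ^ 2) / δ ^ 2 / n +
        2 * (Fintype.card A * (4 / Real.log 2 ^ 2)) / δ ^ 2 / n +
          √((2 : ℝ) ^ (2 * (h + δ) + C - 2 * δ * n))) atTop (nhds (0 + 0 + √0)) := by
    refine ((tendsto_const_div_atTop_nhds_zero_nat _).add
      (tendsto_const_div_atTop_nhds_zero_nat _)).add ?_
    refine (Real.continuous_sqrt.tendsto 0).comp ?_
    refine (tendsto_rpow_atBot_of_base_gt_one 2 (by norm_num)).comp ?_
    refine tendsto_atBot_add_const_left _ _ ?_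
    exact tendsto_neg_atTop_atBot.comp
      (tendsto_natCast_atTop_atTop.const_mul_atTop (by positivity))
  simp only [Real.sqrt_zero, add_zero] at hlim
  filter_upwards [hlim.eventually_le_const hε, eventually_gt_atTop 0] with n hn hn0
  obtain ⟨f, hf⟩ := exists_extractionError_le hp hq hδ0 (by rw [hδ]; linarith) hC hn0
  exact ⟨f, hf.trans hn⟩

end Extraction

/-! ### Time sharing and the concave envelope of `J` -/

section Envelope

variable {A B : Type*} [Fintype A] [Fintype B]

lemma entropy_nonneg {q : A → ℝ} (h0 : ∀ a, 0 ≤ q a) (h1 : ∀ a, q a ≤ 1) : 0 ≤ entropy q :=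
  Finset.sum_nonneg fun a _ => neg_nonneg.2 <| mul_nonpos_of_nonneg_of_nonpos (h0 a)
    (Real.logb_nonpos one_lt_two (h0 a) (h1 a))

lemma entropy_single [DecidableEq A] (a : A) : entropy (Pi.single a (1 : ℝ)) = 0 := by
  refine Finset.sum_eq_zero fun b _ => ?_
  by_cases h : b = a
  · subst h; simp
  · simp [h]

/-- A bound on the absolute values of all payoffs. -/
noncomputable def payoffBound (u : A → B → ℝ) : ℝ := ∑ a, ∑ b, |u a b|

lemma payoffBound_nonneg (u : A → B → ℝ) : 0 ≤ payoffBound u :=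
  Finset.sum_nonneg fun _ _ => Finset.sum_nonneg fun _ _ => abs_nonneg _

lemma abs_payoff_le (u : A → B → ℝ) (a : A) (b : B) : |u a b| ≤ payoffBound u :=
  (Finset.single_le_sum (f := fun b => |u a b|) (fun _ _ => abs_nonneg _) (Finset.mem_univ b)).trans
    (Finset.single_le_sum (f := fun a => ∑ b, |u a b|)
      (fun _ _ => Finset.sum_nonneg fun _ _ => abs_nonneg _) (Finset.mem_univ a))

lemma abs_sum_mul_le {q : A → ℝ} (hq : q ∈ stdSimplex ℝ A) {r : A → ℝ} {M : ℝ}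
    (hr : ∀ a, |r a| ≤ M) : |∑ a, q a * r a| ≤ M := by
  calc _ ≤ ∑ a, |q a * r a| := Finset.abs_sum_le_sum_abs _ _
    _ ≤ ∑ a, q a * M := Finset.sum_le_sum fun a _ => by
        rw [abs_mul, abs_of_nonneg (hq.1 a)]
        exact mul_le_mul_of_nonneg_left (hr a) (hq.1 a)
    _ = M := by rw [← Finset.sum_mul, hq.2, one_mul]

lemma securityLevel_le (u : A → B → ℝ) (q : A → ℝ) (b : B) :
    securityLevel u q ≤ ∑ a, q a * u a b :=
  ciInf_le (Set.finite_range _).bddBelow b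

/-- Serves the case `H(X|Y) = 0`, where Alice's target must be playable without randomness. -/
lemma eq_single_of_entropy_le_zero {A : Type*} [Fintype A] [DecidableEq A] {q : A → ℝ} (hq : q ∈ stdSimplex ℝ A)
    (h : entropy q ≤ 0) : ∃ a, q = Pi.single a 1 := by
  have hterm : ∀ a ∈ Finset.univ, 0 ≤ -(q a * Real.logb 2 (q a)) := fun a _ =>
    neg_nonneg.2 <| mul_nonpos_of_nonneg_of_nonpos (hq.1 a)
      (Real.logb_nonpos one_lt_two (hq.1 a) (le_one_of_mem_stdSimplex hq a))
  have h0 := (Finset.sum_eq_zero_iff_of_nonneg hterm).1 (le_antisymm h (Finset.sum_nonneg hterm))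
  have h01 : ∀ a, q a = 0 ∨ q a = 1 := by
    intro a
    have h1 := h0 a (Finset.mem_univ a)
    rw [neg_eq_zero, mul_eq_zero, Real.logb_eq_zero] at h1
    have := hq.1 a
    rcases h1 with h1 | h1 | h1 | h1 | h1 | h1 | h1
    all_goals first
      | exact Or.inl h1
      | exact Or.inr h1
      | (exfalso; linarith)
  obtain ⟨a, ha⟩ : ∃ a, q a = 1 := by
    by_contra! hne
    have : ∑ a, q a = 0 := Finset.sum_eq_zero fun a _ => (h01 a).resolve_right (hne a)
    linarith [hq.2]
  refine ⟨a, funext fun b => ?_⟩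
  by_cases hb : b = a
  · subst hb; simp [ha]
  · rw [Pi.single_eq_of_ne hb]
    refine (h01 b).resolve_right fun hb1 => ?_
    have := Finset.add_le_sum (f := q) (s := Finset.univ) (fun i _ => hq.1 i)
      (Finset.mem_univ b) (Finset.mem_univ a) hb
    linarith [hq.2]

lemma exists_mem_stdSimplex_entropy_le {A : Type*} [Fintype A] [Nonempty A] {h : ℝ} (hh : 0 ≤ h) :
    ∃ q ∈ stdSimplex ℝ A, entropy q ≤ h := by
  classical
  obtain ⟨a⟩ := ‹Nonempty A›
  exact ⟨_, single_mem_stdSimplex ℝ a, (entropy_single a).trans_le hh⟩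

lemma J_le {A B : Type*} [Fintype A] [Nonempty A] (u : A → B → ℝ) {h c : ℝ} (hh : 0 ≤ h)
    (hc : ∀ q ∈ stdSimplex ℝ A, entropy q ≤ h → securityLevel u q ≤ c) : J u h ≤ c := by
  obtain ⟨q, hq, hqh⟩ := exists_mem_stdSimplex_entropy_le (A := A) hh
  refine csSup_le ⟨_, q, ⟨hq, hqh⟩, rfl⟩ ?_
  rintro _ ⟨q, ⟨hq, hqh⟩, rfl⟩
  exact hc q hq hqh

/-- `(h, v)` is achievable if some sequence of mixed actions has, up to a bounded error, total
entropy at most `n * h` and total security level at least `n * v` over its first `n` terms. -/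
def Achievable {A B : Type*} [Fintype A] (u : A → B → ℝ) (h v : ℝ) : Prop :=
  ∃ q : ℕ → A → ℝ, (∀ t, q t ∈ stdSimplex ℝ A) ∧ ∃ C : ℝ, ∀ n : ℕ,
    ∑ t ∈ Finset.range n, entropy (q t) ≤ n * h + C ∧
      n * v - C ≤ ∑ t ∈ Finset.range n, securityLevel u (q t)

lemma achievable_of_mem_stdSimplex {A B : Type*} [Fintype A] (u : A → B → ℝ) {q : A → ℝ} (hq : q ∈ stdSimplex ℝ A) {h v : ℝ}
    (hh : entropy q ≤ h) (hv : v ≤ securityLevel u q) : Achievable u h v :=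
  ⟨fun _ => q, fun _ => hq, 0, fun n => by
    simp only [Finset.sum_const, Finset.card_range, nsmul_eq_mul, add_zero, sub_zero]
    exact ⟨mul_le_mul_of_nonneg_left hh n.cast_nonneg, mul_le_mul_of_nonneg_left hv n.cast_nonneg⟩⟩

lemma Achievable.mono {A B : Type*} [Fintype A] {u : A → B → ℝ} {h h' v v' : ℝ} (H : Achievable u h v) (hh : h ≤ h')
    (hv : v' ≤ v) : Achievable u h' v' := by
  obtain ⟨q, hq, C, hC⟩ := H
  refine ⟨q, hq, C, fun n => ⟨(hC n).1.trans ?_, le_trans ?_ (hC n).2⟩⟩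
  · have := mul_le_mul_of_nonneg_left hh n.cast_nonneg (α := ℝ)
    linarith
  · have := mul_le_mul_of_nonneg_left hv n.cast_nonneg (α := ℝ)
    linarith

/-- Interleaving two sequences so that the first is used at a fraction `c` of the stages. -/
noncomputable def interleave {α : Type*} (c : ℝ) (q₁ q₂ : ℕ → α) (t : ℕ) : α :=
  if ⌊t * c⌋₊ < ⌊(t + 1) * c⌋₊ then q₁ ⌊t * c⌋₊ else q₂ (t - ⌊t * c⌋₊)

/-- Before stage `t` the first sequence has been used `⌊t * c⌋₊` times, a count that grows by at
most one per stage because `c ≤ 1`. -/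
lemma sum_interleave {α : Type*} {c : ℝ} (hc0 : 0 ≤ c) (hc1 : c ≤ 1) (q₁ q₂ : ℕ → α)
    (F : α → ℝ) (n : ℕ) :
    ∑ t ∈ Finset.range n, F (interleave c q₁ q₂ t) =
      ∑ t ∈ Finset.range ⌊n * c⌋₊, F (q₁ t) + ∑ t ∈ Finset.range (n - ⌊n * c⌋₊), F (q₂ t) := by
  induction n with
  | zero => simp
  | succ n ih =>
    have hle : ⌊n * c⌋₊ ≤ n := Nat.floor_le_of_le (mul_le_of_le_one_right n.cast_nonneg hc1)
    have h1 : ⌊n * c⌋₊ ≤ ⌊((n : ℝ) + 1) * c⌋₊ := Nat.floor_mono (by nlinarith)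
    have h2 : ⌊((n : ℝ) + 1) * c⌋₊ ≤ ⌊n * c⌋₊ + 1 := by
      rw [← Nat.floor_add_one (by positivity)]
      exact Nat.floor_mono (by nlinarith)
    rw [Finset.sum_range_succ, ih, interleave]
    push_cast
    split_ifs with h
    · have h3 : ⌊((n : ℝ) + 1) * c⌋₊ = ⌊n * c⌋₊ + 1 := by omega
      rw [h3, Finset.sum_range_succ, show n + 1 - (⌊n * c⌋₊ + 1) = n - ⌊n * c⌋₊ by omega]
      ring
    · have h3 : ⌊((n : ℝ) + 1) * c⌋₊ = ⌊n * c⌋₊ := by omega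
      rw [h3, show n + 1 - ⌊n * c⌋₊ = n - ⌊n * c⌋₊ + 1 by omega, Finset.sum_range_succ]
      ring

/-- Time sharing. The number of uses of each sequence is within one of its ideal share at every
time, so the error stays bounded. -/
lemma Achievable.convexComb {A B : Type*} [Fintype A] {u : A → B → ℝ} {h₁ h₂ v₁ v₂ c d : ℝ} (H₁ : Achievable u h₁ v₁)
    (H₂ : Achievable u h₂ v₂) (hc : 0 ≤ c) (hd : 0 ≤ d) (hcd : c + d = 1) :
    Achievable u (c * h₁ + d * h₂) (c * v₁ + d * v₂) := by
  obtain ⟨q₁, hq₁, C₁, hC₁⟩ := H₁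
  obtain ⟨q₂, hq₂, C₂, hC₂⟩ := H₂
  refine ⟨interleave c q₁ q₂, fun t => ?_, C₁ + C₂ + |h₁ - h₂| + |v₁ - v₂|, fun n => ?_⟩
  · rw [interleave]
    split_ifs
    exacts [hq₁ _, hq₂ _]
  have hc1 : c ≤ 1 := by linarith
  rw [sum_interleave hc hc1, sum_interleave hc hc1]
  have hle : ⌊n * c⌋₊ ≤ n := Nat.floor_le_of_le (mul_le_of_le_one_right n.cast_nonneg hc1)
  have h1 := hC₁ ⌊n * c⌋₊
  have h2 := hC₂ (n - ⌊n * c⌋₊)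
  rw [Nat.cast_sub hle] at h2
  set k : ℝ := (⌊n * c⌋₊ : ℝ) with hk
  have hk1 : |n * c - k| ≤ 1 := by
    have h3 := Nat.floor_le (show 0 ≤ n * c by positivity)
    have h4 := Nat.lt_floor_add_one (n * c)
    rw [abs_le]
    constructor <;> linarith
  have key : ∀ r s : ℝ, |n * (c * r + d * s) - (k * r + (n - k) * s)| ≤ |r - s| := by
    intro r s
    have : n * (c * r + d * s) - (k * r + (n - k) * s) = (n * c - k) * (r - s) := by
      rw [show d = 1 - c by linarith]; ring
    rw [this, abs_mul]
    exact mul_le_of_le_one_left (abs_nonneg _) hk1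
  have h3 := abs_le.1 (key h₁ h₂)
  have h4 := abs_le.1 (key v₁ v₂)
  have h5 := abs_nonneg (h₁ - h₂)
  have h6 := abs_nonneg (v₁ - v₂)
  constructor <;> linarith [h1.1, h1.2, h2.1, h2.2]

variable [Nonempty B]

lemma exists_securityLevel_eq (u : A → B → ℝ) (q : A → ℝ) :
    ∃ b, ∑ a, q a * u a b = securityLevel u q :=
  exists_eq_ciInf_of_finite

lemma abs_securityLevel_le (u : A → B → ℝ) {q : A → ℝ} (hq : q ∈ stdSimplex ℝ A) :
    |securityLevel u q| ≤ payoffBound u := by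
  obtain ⟨b, hb⟩ := exists_securityLevel_eq u q
  rw [← hb]
  exact abs_sum_mul_le hq fun a => abs_payoff_le u a b

lemma securityLevel_le_J (u : A → B → ℝ) {q : A → ℝ} (hq : q ∈ stdSimplex ℝ A) {h : ℝ}
    (hh : entropy q ≤ h) : securityLevel u q ≤ J u h :=
  le_csSup ⟨payoffBound u, by
    rintro _ ⟨q, ⟨hq, -⟩, rfl⟩
    exact (abs_le.1 (abs_securityLevel_le u hq)).2⟩ ⟨q, ⟨hq, hh⟩, rfl⟩

lemma Achievable.le_payoffBound {u : A → B → ℝ} {h v : ℝ} (H : Achievable u h v) :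
    v ≤ payoffBound u := by
  obtain ⟨q, hq, C, hC⟩ := H
  by_contra! hlt
  obtain ⟨n, hn⟩ := exists_nat_gt (C / (v - payoffBound u))
  rw [div_lt_iff₀ (by linarith)] at hn
  have h1 : ∑ t ∈ Finset.range n, securityLevel u (q t) ≤ n * payoffBound u := by
    refine (Finset.sum_le_sum fun t _ => (abs_le.1 (abs_securityLevel_le u (hq t))).2).trans ?_
    simp
  linarith [(hC n).2]

variable [Nonempty A]

lemma J_le_payoffBound (u : A → B → ℝ) {h : ℝ} (hh : 0 ≤ h) : J u h ≤ payoffBound u :=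
  J_le u hh fun _ hq _ => (abs_le.1 (abs_securityLevel_le u hq)).2

lemma neg_payoffBound_le_J (u : A → B → ℝ) {h : ℝ} (hh : 0 ≤ h) : -payoffBound u ≤ J u h := by
  obtain ⟨q, hq, hqh⟩ := exists_mem_stdSimplex_entropy_le (A := A) hh
  exact (abs_le.1 (abs_securityLevel_le u hq)).1.trans (securityLevel_le_J u hq hqh)

lemma concaveEnvelope_J_le (u : A → B → ℝ) {g : ℝ → ℝ} (hg : ConcaveOn ℝ (Set.Ici 0) g)
    (hJ : ∀ s ∈ Set.Ici (0 : ℝ), J u s ≤ g s) {h : ℝ} (hh : 0 ≤ h) :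
    concaveEnvelope (J u) h ≤ g h :=
  csInf_le ⟨-payoffBound u, by
    rintro _ ⟨g, -, hg, rfl⟩
    exact (neg_payoffBound_le_J u hh).trans (hg h hh)⟩ ⟨g, hg, hJ, rfl⟩

lemma le_concaveEnvelope_J (u : A → B → ℝ) {h c : ℝ}
    (hc : ∀ g : ℝ → ℝ, ConcaveOn ℝ (Set.Ici 0) g → (∀ s ∈ Set.Ici (0 : ℝ), J u s ≤ g s) →
      c ≤ g h) : c ≤ concaveEnvelope (J u) h := by
  refine le_csInf ⟨_, fun _ => payoffBound u, concaveOn_const _ (convex_Ici 0),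
    fun s hs => J_le_payoffBound u hs, rfl⟩ ?_
  rintro _ ⟨g, hg, hJ, rfl⟩
  exact hc g hg hJ

/-- A concave function on `[0, ∞)` that is bounded below is nondecreasing. -/
lemma monotoneOn_of_concaveOn_of_bddBelow {g : ℝ → ℝ} (hg : ConcaveOn ℝ (Set.Ici 0) g) {c : ℝ}
    (hc : ∀ s ∈ Set.Ici (0 : ℝ), c ≤ g s) : MonotoneOn g (Set.Ici 0) := by
  intro s hs t ht hst
  by_contra! hlt
  have hs' : 0 ≤ s := hs
  have hst' : s < t := lt_of_le_of_ne hst fun h => by subst h; exact lt_irrefl _ hlt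
  set m := (g s - g t) / (t - s) with hm
  have hm0 : 0 < m := div_pos (by linarith) (by linarith)
  -- A decrease at slope `-m` between `s` and `t` persists, by concavity, and brings `g` down to `c
  -- - 1` at `r`.
  set r := t + (g t - c + 1) / m with hr
  have hgt : 0 ≤ g t - c := by linarith [hc t ht]
  have htr : t < r := by
    have : 0 < (g t - c + 1) / m := by positivity
    linarith
  have h := hg.slope_anti_adjacent hs (show r ∈ Set.Ici (0 : ℝ) from hs'.trans (by linarith)) hst' htr
  have h1 : (g t - g s) / (t - s) = -m := by rw [hm, ← neg_div]; ring
  rw [h1, div_le_iff₀ (by linarith)] at h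
  have h2 : m * (r - t) = g t - c + 1 := by rw [hr]; field_simp; ring
  have := hc r (hs'.trans (by linarith))
  linarith

/-- Values below the concave envelope are achievable. -/
lemma achievable_of_lt_concaveEnvelope (u : A → B → ℝ) {h v : ℝ} (hh : 0 ≤ h)
    (hv : v < concaveEnvelope (J u) h) : Achievable u h v := by
  -- The best achievable value is itself a concave majorant of `J u`, hence lies above the envelope.
  set D : ℝ → ℝ := fun s => sSup {v | Achievable u s v} with hD
  have hbdd : ∀ s, BddAbove {v | Achievable u s v} := fun s =>
    ⟨payoffBound u, fun v hv => hv.le_payoffBound⟩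
  have hne : ∀ s, 0 ≤ s → {v | Achievable u s v}.Nonempty := fun s hs => by
    obtain ⟨q, hq, hqs⟩ := exists_mem_stdSimplex_entropy_le (A := A) hs
    exact ⟨_, achievable_of_mem_stdSimplex u hq hqs le_rfl⟩
  have hconc : ConcaveOn ℝ (Set.Ici 0) D := by
    refine ⟨convex_Ici 0, fun s hs t ht c d hc hd hcd => ?_⟩
    refine le_of_forall_pos_sub_le fun ε hε => ?_
    obtain ⟨v₁, hv₁, hv₁'⟩ := exists_lt_of_lt_csSup (hne s hs) (show D s - ε < D s by linarith)
    obtain ⟨v₂, hv₂, hv₂'⟩ := exists_lt_of_lt_csSup (hne t ht) (show D t - ε < D t by linarith)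
    have h1 : c * v₁ + d * v₂ ≤ D (c * s + d * t) :=
      le_csSup (hbdd _) (hv₁.convexComb hv₂ hc hd hcd)
    simp only [smul_eq_mul]
    have h2 := mul_le_mul_of_nonneg_left hv₁'.le hc
    have h3 := mul_le_mul_of_nonneg_left hv₂'.le hd
    have h4 : c * ε + d * ε = ε := by rw [← add_mul, hcd, one_mul]
    linarith
  have hJ : ∀ s ∈ Set.Ici (0 : ℝ), J u s ≤ D s := fun s hs =>
    J_le u hs fun q hq hqs => le_csSup (hbdd s) (achievable_of_mem_stdSimplex u hq hqs le_rfl)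
  obtain ⟨v', hv', hlt⟩ := exists_lt_of_lt_csSup (hne h hh)
    (hv.trans_le (concaveEnvelope_J_le u hconc hJ hh))
  exact Achievable.mono hv' le_rfl hlt.le

/-- Extraction needs an entropy rate strictly below that of the source. Playing a law of zero
entropy in a small fraction of the stages frees some entropy at little cost. -/
lemma exists_achievable_of_lt_concaveEnvelope (u : A → B → ℝ) {h v : ℝ} (hh : 0 < h)
    (hv : v < concaveEnvelope (J u) h) : ∃ h' < h, Achievable u h' v := by
  obtain ⟨v', hv', hv'h⟩ := exists_between hv
  obtain ⟨q, hq, hq0⟩ := exists_mem_stdSimplex_entropy_le (A := A) le_rfl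
  have H₀ := achievable_of_mem_stdSimplex u hq hq0 le_rfl
  have H₁ := achievable_of_lt_concaveEnvelope u hh.le hv'h
  have hS := (abs_le.1 (abs_securityLevel_le u hq)).1
  have hB := payoffBound_nonneg u
  -- The mixture loses at most `c * (|v'| + payoffBound u)`, which is at most `v' - v`; the last
  -- summand of the denominator ensures `c ≤ 1`.
  set c := (v' - v) / (|v'| + payoffBound u + (v' - v)) with hc
  have hpos : 0 < |v'| + payoffBound u + (v' - v) := by
    linarith [abs_nonneg v']
  have hc0 : 0 < c := div_pos (by linarith) hpos
  have hc1 : c ≤ 1 := (div_le_one hpos).2 (by linarith [abs_nonneg v'])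
  have H := H₀.convexComb H₁ hc0.le (show 0 ≤ 1 - c by linarith) (by ring)
  refine ⟨_, ?_, H.mono le_rfl ?_⟩
  · nlinarith
  · have h1 : c * (|v'| + payoffBound u + (v' - v)) = v' - v := by
      rw [hc]; field_simp
    have h2 := le_abs_self v'
    nlinarith

/-- Without entropy, the concave envelope is no better than a pure action. -/
lemma concaveEnvelope_J_zero_le (u : A → B → ℝ) : concaveEnvelope (J u) 0 ≤ J u 0 := by
  -- A concave function may jump up at the endpoint of its domain, so this majorant is exact at `0`.
  set g : ℝ → ℝ := fun s => if s = 0 then J u 0 else payoffBound u with hg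
  have hgle : ∀ s, g s ≤ payoffBound u := fun s => by
    simp only [hg]
    split_ifs
    exacts [J_le_payoffBound u le_rfl, le_rfl]
  refine (concaveEnvelope_J_le u (g := g) ?_ ?_ le_rfl).trans (by simp [hg])
  · refine ⟨convex_Ici 0, fun s hs t ht c d hc hd hcd => ?_⟩
    have hs' : 0 ≤ s := hs
    have ht' : 0 ≤ t := ht
    simp only [smul_eq_mul]
    by_cases h : c * s + d * t = 0
    · have h1 : c * s = 0 := by nlinarith [mul_nonneg hc hs', mul_nonneg hd ht']
      have h2 : d * t = 0 := by nlinarith [mul_nonneg hc hs', mul_nonneg hd ht']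
      have h3 : ∀ {c s : ℝ}, c * s = 0 → c * g s = c * J u 0 := by
        intro c s h
        rcases mul_eq_zero.1 h with h | h <;> simp [h, hg]
      rw [h, h3 h1, h3 h2, ← add_mul, hcd, one_mul]
      simp [hg]
    · have h1 : g (c * s + d * t) = payoffBound u := by simp [hg, h]
      rw [h1]
      calc c * g s + d * g t ≤ c * payoffBound u + d * payoffBound u :=
            add_le_add (mul_le_mul_of_nonneg_left (hgle s) hc)
              (mul_le_mul_of_nonneg_left (hgle t) hd)
        _ = payoffBound u := by rw [← add_mul, hcd, one_mul]
  · intro s hs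
    simp only [hg]
    split_ifs with h
    · rw [h]
    · exact J_le_payoffBound u hs

end Envelope

noncomputable section

/-! ### Expectations in the repeated game -/

/-- Appending a last term to a finite sequence. -/
abbrev snoc {X : Type*} {T : ℕ} (x : Fin T → X) (x' : X) : Fin (T + 1) → X :=
  Fin.snoc (α := fun _ => X) x x'

lemma sum_fun_snoc {X M : Type*} [Fintype X] [AddCommMonoid M] {T : ℕ}
    (F : (Fin (T + 1) → X) → M) : ∑ x, F x = ∑ x : Fin T → X, ∑ x', F (snoc x x') := by
  rw [Finset.sum_comm, ← Fintype.sum_prod_type' (fun (x' : X) (x : Fin T → X) => F (snoc x x'))]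
  exact (Fintype.sum_equiv (Fin.snocEquiv fun _ : Fin (T + 1) => X) _ _ fun z => rfl).symm

lemma pastActions_snoc_castSucc {A B : Type*} {T : ℕ} (a : Fin T → A) (b : Fin T → B) (a' : A)
    (b' : B) (t : Fin T) :
    pastActions (snoc a a') (snoc b b') t.castSucc = pastActions a b t := by
  funext i
  have h : Fin.castLE (t.castSucc).is_lt.le i = Fin.castSucc (Fin.castLE t.is_lt.le i) := rfl
  simp only [pastActions, h, snoc, Fin.snoc_castSucc]

lemma pastActions_snoc_last {A B : Type*} {T : ℕ} (a : Fin T → A) (b : Fin T → B) (a' : A)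
    (b' : B) :
    pastActions (snoc a a') (snoc b b') (Fin.last T) = fun i : Fin T => (a i, b i) := by
  funext i
  have h : Fin.castLE (Fin.last T).is_lt.le i = Fin.castSucc (n := T) i := rfl
  simp only [pastActions, h, snoc, Fin.snoc_castSucc]

lemma upTo_snoc_castSucc {X : Type*} {T : ℕ} (x : Fin T → X) (x' : X) (t : Fin T) :
    upTo (snoc x x') t.castSucc = upTo x t := by
  funext i
  have h : Fin.castLE (Nat.succ_le_of_lt (t.castSucc).is_lt) i =
    Fin.castSucc (Fin.castLE (Nat.succ_le_of_lt t.is_lt) i) := rfl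
  simp only [upTo, h, snoc, Fin.snoc_castSucc]

lemma upTo_last {X : Type*} {T : ℕ} (x : Fin (T + 1) → X) : upTo x (Fin.last T) = x := rfl

section BobWeight

variable {Y A B : Type*} [Fintype B]

/-- The factor of `playProb` that is due to Bob. -/
def bobWeight (τ : BobStrategy Y A B) {T : ℕ} (y : Fin T → Y) (a : Fin T → A) (b : Fin T → B) : ℝ :=
  ∏ t : Fin T, (τ t (pastActions a b t) (upTo y t)).1 (b t)

lemma bobWeight_snoc (τ : BobStrategy Y A B) {T : ℕ} (y : Fin T → Y) (a : Fin T → A)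
    (b : Fin T → B) (y' : Y) (a' : A) (b' : B) :
    bobWeight τ (snoc y y') (snoc a a') (snoc b b') =
      bobWeight τ y a b * (τ T (fun i => (a i, b i)) (snoc y y')).1 b' := by
  rw [bobWeight, Fin.prod_univ_castSucc]
  congr 1
  · refine Finset.prod_congr rfl fun t _ => ?_
    rw [pastActions_snoc_castSucc, upTo_snoc_castSucc]
    simp only [snoc, Fin.snoc_castSucc]
    rfl
  · rw [pastActions_snoc_last, upTo_last]
    simp only [snoc, Fin.snoc_last]
    rfl

lemma bobWeight_nonneg (τ : BobStrategy Y A B) {T : ℕ} (y : Fin T → Y) (a : Fin T → A)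
    (b : Fin T → B) : 0 ≤ bobWeight τ y a b :=
  Finset.prod_nonneg fun _ _ => (τ _ _ _).2.1 _

/-- With `y` and `a` imposed from outside, `bobWeight` is the law of Bob's replies. -/
lemma sum_bobWeight (τ : BobStrategy Y A B) {T : ℕ} (y : Fin T → Y) (a : Fin T → A) :
    ∑ b, bobWeight τ y a b = 1 := by
  induction T with
  | zero => simp [bobWeight]
  | succ T ih =>
    rw [sum_fun_snoc, ← Fin.snoc_init_self y, ← Fin.snoc_init_self a]
    simp only [bobWeight_snoc, ← Finset.mul_sum, (τ _ _ _).2.2, mul_one]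
    exact ih _ _

end BobWeight

section Expectation

variable {X Y A B : Type*} [DecidableEq A]

/-- The factor of `playProb` that is due to the source and to Alice. -/
def aliceWeight (p : X × Y → ℝ) (σ : AliceStrategy X A B) {T : ℕ}
    (x : Fin T → X) (y : Fin T → Y) (a : Fin T → A) (b : Fin T → B) : ℝ :=
  ∏ t : Fin T, p (x t, y t) * (if a t = σ t (pastActions a b t) (upTo x t) then 1 else 0)

lemma aliceWeight_snoc (p : X × Y → ℝ) (σ : AliceStrategy X A B) {T : ℕ}
    (x : Fin T → X) (y : Fin T → Y) (a : Fin T → A) (b : Fin T → B) (x' : X) (y' : Y) (a' : A)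
    (b' : B) :
    aliceWeight p σ (snoc x x') (snoc y y') (snoc a a') (snoc b b') =
      aliceWeight p σ x y a b *
        (p (x', y') * (if a' = σ T (fun i => (a i, b i)) (snoc x x') then 1 else 0)) := by
  rw [aliceWeight, Fin.prod_univ_castSucc]
  congr 1
  · refine Finset.prod_congr rfl fun t _ => ?_
    rw [pastActions_snoc_castSucc, upTo_snoc_castSucc]
    simp only [snoc, Fin.snoc_castSucc]
    rfl
  · rw [pastActions_snoc_last, upTo_last]
    simp only [snoc, Fin.snoc_last]
    rfl

lemma aliceWeight_nonneg {p : X × Y → ℝ} (hp : ∀ z, 0 ≤ p z) (σ : AliceStrategy X A B) {T : ℕ}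
    (x : Fin T → X) (y : Fin T → Y) (a : Fin T → A) (b : Fin T → B) :
    0 ≤ aliceWeight p σ x y a b :=
  Finset.prod_nonneg fun t _ => mul_nonneg (hp _) (by split_ifs <;> norm_num)

variable [Fintype B]

lemma playProb_eq_mul (p : X × Y → ℝ) (σ : AliceStrategy X A B) (τ : BobStrategy Y A B) {T : ℕ}
    (x : Fin T → X) (y : Fin T → Y) (a : Fin T → A) (b : Fin T → B) :
    playProb p σ τ x y a b = aliceWeight p σ x y a b * bobWeight τ y a b :=
  Finset.prod_mul_distrib

variable [Fintype X] [Fintype Y] [Fintype A]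

/-- The expectation of a function of the first `T` stages. -/
def expect (p : X × Y → ℝ) (σ : AliceStrategy X A B) (τ : BobStrategy Y A B) (T : ℕ)
    (F : (Fin T → X) → (Fin T → Y) → (Fin T → A) → (Fin T → B) → ℝ) : ℝ :=
  ∑ x, ∑ y, ∑ a, ∑ b, playProb p σ τ x y a b * F x y a b

/-- Restricting to nonzero weight makes the rules for logarithms of products and quotients
available. -/
lemma expect_congr {p : X × Y → ℝ} {σ : AliceStrategy X A B} {τ : BobStrategy Y A B} {T : ℕ}
    {F G : (Fin T → X) → (Fin T → Y) → (Fin T → A) → (Fin T → B) → ℝ}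
    (h : ∀ x y a b, aliceWeight p σ x y a b ≠ 0 → F x y a b = G x y a b) :
    expect p σ τ T F = expect p σ τ T G := by
  refine Finset.sum_congr rfl fun x _ => Finset.sum_congr rfl fun y _ =>
    Finset.sum_congr rfl fun a _ => Finset.sum_congr rfl fun b _ => ?_
  rw [playProb_eq_mul]
  by_cases h0 : aliceWeight p σ x y a b = 0
  · simp [h0]
  · rw [h _ _ _ _ h0]

lemma expect_add (p : X × Y → ℝ) (σ : AliceStrategy X A B) (τ : BobStrategy Y A B) {T : ℕ}
    (F G : (Fin T → X) → (Fin T → Y) → (Fin T → A) → (Fin T → B) → ℝ) :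
    expect p σ τ T (fun x y a b => F x y a b + G x y a b) =
      expect p σ τ T F + expect p σ τ T G := by
  simp only [expect, mul_add, Finset.sum_add_distrib]

lemma expect_mono {p : X × Y → ℝ} (hp : ∀ z, 0 ≤ p z) (σ : AliceStrategy X A B)
    (τ : BobStrategy Y A B) {T : ℕ}
    {F G : (Fin T → X) → (Fin T → Y) → (Fin T → A) → (Fin T → B) → ℝ}
    (h : ∀ x y a b, F x y a b ≤ G x y a b) : expect p σ τ T F ≤ expect p σ τ T G := by
  refine Finset.sum_le_sum fun x _ => Finset.sum_le_sum fun y _ =>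
    Finset.sum_le_sum fun a _ => Finset.sum_le_sum fun b _ => ?_
  rw [playProb_eq_mul]
  exact mul_le_mul_of_nonneg_left (h x y a b)
    (mul_nonneg (aliceWeight_nonneg hp σ x y a b) (bobWeight_nonneg τ y a b))

/-- The source symbols of a stage are independent of the earlier stages. -/
lemma expect_succ_mul (p : X × Y → ℝ) (σ : AliceStrategy X A B) (τ : BobStrategy Y A B) {T : ℕ}
    (F : (Fin T → X) → (Fin T → Y) → (Fin T → A) → (Fin T → B) → ℝ) (l : X → Y → ℝ) :
    expect p σ τ (T + 1) (fun x y a b =>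
      F (Fin.init x) (Fin.init y) (Fin.init a) (Fin.init b) * l (x (Fin.last T)) (y (Fin.last T))) =
      expect p σ τ T F * ∑ x, ∑ y, p (x, y) * l x y := by
  have h1 : ∀ (x : Fin T → X) (x' : X) (y : Fin T → Y) (y' : Y),
      ∑ a : Fin (T + 1) → A, ∑ b : Fin (T + 1) → B, playProb p σ τ (snoc x x') (snoc y y') a b *
        (F x y (Fin.init a) (Fin.init b) * l x' y') =
      (∑ a, ∑ b, playProb p σ τ x y a b * F x y a b) * (p (x', y') * l x' y') := by
    intro x x' y y'
    rw [sum_fun_snoc, Finset.sum_mul]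
    refine Finset.sum_congr rfl fun a _ => ?_
    simp only [sum_fun_snoc (X := B)]
    rw [Finset.sum_comm, Finset.sum_mul]
    refine Finset.sum_congr rfl fun b _ => ?_
    simp only [playProb_eq_mul, aliceWeight_snoc, bobWeight_snoc, snoc, Fin.init_snoc]
    have h2 : ∀ (a' : A) (b' : B), aliceWeight p σ x y a b *
        (p (x', y') * (if a' = σ T (fun i => (a i, b i)) (Fin.snoc (α := fun _ => X) x x')
          then 1 else 0)) *
        (bobWeight τ y a b * (τ T (fun i => (a i, b i)) (Fin.snoc (α := fun _ => Y) y y')).1 b') *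
        (F x y a b * l x' y') =
        (aliceWeight p σ x y a b * bobWeight τ y a b * F x y a b * (p (x', y') * l x' y')) *
        ((if a' = σ T (fun i => (a i, b i)) (Fin.snoc (α := fun _ => X) x x') then 1 else 0) *
          (τ T (fun i => (a i, b i)) (Fin.snoc (α := fun _ => Y) y y')).1 b') :=
      fun a' b' => by ring
    simp only [h2, ← Finset.mul_sum, (τ _ _ _).2.2, mul_one]
    simp
  rw [expect, sum_fun_snoc, expect, Finset.sum_mul]
  refine Finset.sum_congr rfl fun x _ => ?_
  simp only [sum_fun_snoc (X := Y)]
  rw [Finset.sum_comm, Finset.sum_mul]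
  refine Finset.sum_congr rfl fun y _ => ?_
  rw [Finset.mul_sum]
  refine Finset.sum_congr rfl fun x' _ => ?_
  rw [Finset.mul_sum]
  refine Finset.sum_congr rfl fun y' _ => ?_
  rw [← h1]
  simp [snoc]

variable {p : X × Y → ℝ}

lemma expect_init (hp : p ∈ stdSimplex ℝ (X × Y)) (σ : AliceStrategy X A B) (τ : BobStrategy Y A B)
    {T : ℕ} (F : (Fin T → X) → (Fin T → Y) → (Fin T → A) → (Fin T → B) → ℝ) :
    expect p σ τ (T + 1) (fun x y a b =>
      F (Fin.init x) (Fin.init y) (Fin.init a) (Fin.init b)) = expect p σ τ T F := by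
  have h := expect_succ_mul p σ τ F fun _ _ => 1
  simp only [mul_one] at h
  rw [h, ← Fintype.sum_prod_type, hp.2, mul_one]

lemma expect_const (hp : p ∈ stdSimplex ℝ (X × Y)) (σ : AliceStrategy X A B)
    (τ : BobStrategy Y A B) (T : ℕ) (c : ℝ) : expect p σ τ T (fun _ _ _ _ => c) = c := by
  induction T with
  | zero => simp [expect, playProb]
  | succ T ih => exact (expect_init hp σ τ fun _ _ _ _ => c).trans ih

lemma expect_last (hp : p ∈ stdSimplex ℝ (X × Y)) (σ : AliceStrategy X A B) (τ : BobStrategy Y A B)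
    {T : ℕ} (l : X → Y → ℝ) :
    expect p σ τ (T + 1) (fun x y _ _ => l (x (Fin.last T)) (y (Fin.last T))) =
      ∑ x, ∑ y, p (x, y) * l x y := by
  have h := expect_succ_mul p σ τ (T := T) (fun _ _ _ _ => 1) l
  simp only [one_mul] at h
  rw [h, expect_const hp, one_mul]

/-- The expected payoff of Alice at a stage. -/
def stagePayoff (p : X × Y → ℝ) (u : A → B → ℝ) (σ : AliceStrategy X A B) (τ : BobStrategy Y A B)
    (t : ℕ) : ℝ :=
  expect p σ τ (t + 1) fun _ _ a b => u (a (Fin.last t)) (b (Fin.last t))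

lemma avgPayoff_eq (hp : p ∈ stdSimplex ℝ (X × Y)) (u : A → B → ℝ) (σ : AliceStrategy X A B)
    (τ : BobStrategy Y A B) (T : ℕ) :
    avgPayoff p u σ τ T = (1 / (T : ℝ)) * ∑ t ∈ Finset.range T, stagePayoff p u σ τ t := by
  have h : ∀ T, expect p σ τ T (fun _ _ a b => ∑ t, u (a t) (b t)) =
      ∑ t ∈ Finset.range T, stagePayoff p u σ τ t := by
    intro T
    induction T with
    | zero => simp [expect]
    | succ T ih =>
      rw [Finset.sum_range_succ, ← ih, stagePayoff, ← expect_init hp σ τ (T := T), ← expect_add]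
      refine expect_congr fun x y a b _ => ?_
      rw [Fin.sum_univ_castSucc]
      rfl
  rw [← h, expect, Finset.mul_sum]
  simp only [Finset.mul_sum, avgPayoff]
  refine Finset.sum_congr rfl fun x _ => Finset.sum_congr rfl fun y _ =>
    Finset.sum_congr rfl fun a _ => Finset.sum_congr rfl fun b _ => Finset.sum_congr rfl fun t _ => ?_
  ring

lemma abs_stagePayoff_le (hp : p ∈ stdSimplex ℝ (X × Y)) (u : A → B → ℝ) (σ : AliceStrategy X A B)
    (τ : BobStrategy Y A B) (t : ℕ) : |stagePayoff p u σ τ t| ≤ payoffBound u := by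
  rw [abs_le]
  constructor
  · rw [← expect_const hp σ τ (t + 1) (-payoffBound u)]
    exact expect_mono hp.1 σ τ fun _ _ a b => (abs_le.1 (abs_payoff_le u _ _)).1
  · rw [← expect_const hp σ τ (t + 1) (payoffBound u)]
    exact expect_mono hp.1 σ τ fun _ _ a b => (abs_le.1 (abs_payoff_le u _ _)).2

lemma abs_avgPayoff_le (hp : p ∈ stdSimplex ℝ (X × Y)) (u : A → B → ℝ) (σ : AliceStrategy X A B)
    (τ : BobStrategy Y A B) (T : ℕ) : |avgPayoff p u σ τ T| ≤ payoffBound u := by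
  rw [avgPayoff_eq hp]
  rcases Nat.eq_zero_or_pos T with rfl | hT
  · simp [payoffBound_nonneg]
  have hT' : (0 : ℝ) < T := by exact_mod_cast hT
  rw [abs_mul, abs_of_nonneg (by positivity), one_div, inv_mul_le_iff₀ hT']
  refine (Finset.abs_sum_le_sum_abs _ _).trans
    ((Finset.sum_le_sum fun t _ => abs_stagePayoff_le hp u σ τ t).trans ?_)
  simp

end Expectation

/-! ### Bob's defence -/

section Weights

variable {X Y A B : Type*} [Fintype X] [DecidableEq A]

/-- The weight, up to Bob's factor, of the leaked symbols and the actions of a play. -/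
def observedWeight (p : X × Y → ℝ) (σ : AliceStrategy X A B) {T : ℕ} (y : Fin T → Y)
    (a : Fin T → A) (b : Fin T → B) : ℝ :=
  ∑ x, aliceWeight p σ x y a b

/-- The weight, up to Bob's factor, of Alice's action `a'` after the actions `a`, `b` and the leaked
symbols `y`. -/
def actionWeight (p : X × Y → ℝ) (σ : AliceStrategy X A B) {T : ℕ} (y : Fin (T + 1) → Y)
    (a : Fin T → A) (b : Fin T → B) (a' : A) : ℝ :=
  ∑ x : Fin (T + 1) → X, aliceWeight p σ (Fin.init x) (Fin.init y) a b *
    (p (x (Fin.last T), y (Fin.last T)) *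
      (if a' = σ T (fun i => (a i, b i)) x then 1 else 0))

lemma actionWeight_nonneg {p : X × Y → ℝ} (hp : ∀ z, 0 ≤ p z) (σ : AliceStrategy X A B) {T : ℕ}
    (y : Fin (T + 1) → Y) (a : Fin T → A) (b : Fin T → B) (a' : A) :
    0 ≤ actionWeight p σ y a b a' :=
  Finset.sum_nonneg fun _ _ => mul_nonneg (aliceWeight_nonneg hp _ _ _ _ _)
    (mul_nonneg (hp _) (by split_ifs <;> norm_num))

lemma observedWeight_snoc (p : X × Y → ℝ) (σ : AliceStrategy X A B) {T : ℕ} (y : Fin T → Y)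
    (a : Fin T → A) (b : Fin T → B) (y' : Y) (a' : A) (b' : B) :
    observedWeight p σ (snoc y y') (snoc a a') (snoc b b') = actionWeight p σ (snoc y y') a b a' := by
  refine Finset.sum_congr rfl fun x _ => ?_
  conv_lhs => rw [← Fin.snoc_init_self x]
  rw [aliceWeight_snoc]
  simp [snoc]

variable [Fintype A]

/-- Bob's conditional law of Alice's next action. -/
def actionLaw (p : X × Y → ℝ) (σ : AliceStrategy X A B) {T : ℕ} (y : Fin (T + 1) → Y)
    (a : Fin T → A) (b : Fin T → B) (a' : A) : ℝ :=
  actionWeight p σ y a b a' / ∑ a'', actionWeight p σ y a b a''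

lemma sum_actionWeight (p : X × Y → ℝ) (σ : AliceStrategy X A B) {T : ℕ} (y : Fin (T + 1) → Y)
    (a : Fin T → A) (b : Fin T → B) :
    ∑ a', actionWeight p σ y a b a' =
      observedWeight p σ (Fin.init y) a b * ∑ x, p (x, y (Fin.last T)) := by
  simp only [actionWeight]
  rw [Finset.sum_comm, observedWeight, Finset.sum_mul, sum_fun_snoc]
  refine Finset.sum_congr rfl fun x _ => ?_
  rw [Finset.mul_sum]
  refine Finset.sum_congr rfl fun x' _ => ?_
  simp only [← Finset.mul_sum]
  simp [snoc]

/-- A pure best reply at each stage. There is no circularity: Bob's own factor depends only on what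
he observes and cancels in the conditional law, so `actionLaw` does not involve `τ`. -/
lemma exists_defence [Fintype B] [Nonempty B] (p : X × Y → ℝ) (u : A → B → ℝ)
    (σ : AliceStrategy X A B) :
    ∃ τ : BobStrategy Y A B, ∀ (T : ℕ) (y : Fin (T + 1) → Y) (a : Fin T → A) (b : Fin T → B),
      ∑ a', actionLaw p σ y a b a' * ∑ b', (τ T (fun i => (a i, b i)) y).1 b' * u a' b' =
        securityLevel u (actionLaw p σ y a b) := by
  classical
  choose β hβ using fun (q : A → ℝ) => exists_securityLevel_eq u q
  refine ⟨fun T c y => ⟨Pi.single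
    (β (actionLaw p σ y (fun i => (c i).1) fun i => (c i).2)) 1, single_mem_stdSimplex ℝ _⟩,
    fun T y a b => ?_⟩
  rw [← hβ]
  simp [Pi.single_apply]

end Weights

section Defence

variable {X Y A B : Type*} [Fintype X] [Fintype Y] [Fintype A] [DecidableEq A] [Fintype B]

lemma expect_succ_eq_sum (p : X × Y → ℝ) (σ : AliceStrategy X A B) (τ : BobStrategy Y A B) {T : ℕ}
    (F : (Fin (T + 1) → Y) → (Fin T → A) → (Fin T → B) → A → B → ℝ) :
    expect p σ τ (T + 1) (fun _ y a b =>
        F y (Fin.init a) (Fin.init b) (a (Fin.last T)) (b (Fin.last T))) =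
      ∑ y : Fin (T + 1) → Y, ∑ a : Fin T → A, ∑ b : Fin T → B, bobWeight τ (Fin.init y) a b *
        ∑ a', actionWeight p σ y a b a' * ∑ b', (τ T (fun i => (a i, b i)) y).1 b' * F y a b a' b' := by
  rw [expect, Finset.sum_comm]
  refine Finset.sum_congr rfl fun y _ => ?_
  rw [Finset.sum_comm, sum_fun_snoc]
  refine Finset.sum_congr rfl fun a _ => ?_
  simp only [Finset.sum_comm (γ := Fin (T + 1) → X), sum_fun_snoc (X := B)]
  rw [Finset.sum_comm]
  refine Finset.sum_congr rfl fun b _ => ?_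
  rw [Finset.mul_sum]
  refine Finset.sum_congr rfl fun a' _ => ?_
  rw [Finset.mul_sum, Finset.mul_sum]
  refine Finset.sum_congr rfl fun b' _ => ?_
  rw [actionWeight, Finset.sum_mul, Finset.mul_sum]
  refine Finset.sum_congr rfl fun x _ => ?_
  rw [playProb_eq_mul]
  conv_lhs => rw [← Fin.snoc_init_self x, ← Fin.snoc_init_self y]
  rw [aliceWeight_snoc, bobWeight_snoc]
  simp only [snoc, Fin.init_snoc, Fin.snoc_last, Fin.snoc_init_self]
  ring

/-- The expected entropy of Alice's action given what Bob knows when it is played. -/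
def stageEntropy (p : X × Y → ℝ) (σ : AliceStrategy X A B) (τ : BobStrategy Y A B) (t : ℕ) : ℝ :=
  expect p σ τ (t + 1) fun _ y a b =>
    -Real.logb 2 (actionLaw p σ y (Fin.init a) (Fin.init b) (a (Fin.last t)))

/-- The conditional entropy of the source given what Bob has seen in the first `T` stages. -/
def residualEntropy (p : X × Y → ℝ) (σ : AliceStrategy X A B) (τ : BobStrategy Y A B) (T : ℕ) : ℝ :=
  expect p σ τ T fun x y a b => -Real.logb 2 (aliceWeight p σ x y a b / observedWeight p σ y a b)

variable {p : X × Y → ℝ}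

lemma residualEntropy_nonneg (hp : p ∈ stdSimplex ℝ (X × Y)) (σ : AliceStrategy X A B)
    (τ : BobStrategy Y A B) (T : ℕ) : 0 ≤ residualEntropy p σ τ T := by
  rw [← expect_const hp σ τ T 0]
  refine expect_mono hp.1 σ τ fun x y a b => neg_nonneg.2 ?_
  have h0 : ∀ x, 0 ≤ aliceWeight p σ x y a b := fun x => aliceWeight_nonneg hp.1 σ x y a b
  refine Real.logb_nonpos one_lt_two (div_nonneg (h0 x) (Finset.sum_nonneg fun x _ => h0 x)) ?_
  exact div_le_one_of_le₀
    (Finset.single_le_sum (f := fun x => aliceWeight p σ x y a b) (fun x _ => h0 x)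
      (Finset.mem_univ x)) (Finset.sum_nonneg fun x _ => h0 x)

lemma residualEntropy_zero (σ : AliceStrategy X A B) (τ : BobStrategy Y A B) :
    residualEntropy p σ τ 0 = 0 := by
  simp [residualEntropy, expect, observedWeight, aliceWeight]

/-- Each stage brings the entropy `H(X|Y)` of one symbol and costs the entropy of one action. -/
lemma residualEntropy_succ_add (hp : p ∈ stdSimplex ℝ (X × Y)) (σ : AliceStrategy X A B)
    (τ : BobStrategy Y A B) (T : ℕ) :
    residualEntropy p σ τ (T + 1) + stageEntropy p σ τ T =
      residualEntropy p σ τ T + condEntropy p := by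
  have hH : condEntropy p = expect p σ τ (T + 1) fun x y _ _ =>
      -Real.logb 2 (p (x (Fin.last T), y (Fin.last T)) / ∑ x', p (x', y (Fin.last T))) := by
    rw [expect_last hp σ τ fun x y => -Real.logb 2 (p (x, y) / ∑ x', p (x', y))]
    simp only [condEntropy, mul_neg]
  rw [hH, residualEntropy, stageEntropy, residualEntropy, ← expect_init hp σ τ (T := T),
    ← expect_add, ← expect_add]
  refine expect_congr fun x y a b h => ?_
  obtain ⟨x, x', rfl⟩ : ∃ x₀ x', x = snoc x₀ x' := ⟨_, _, (Fin.snoc_init_self x).symm⟩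
  obtain ⟨y, y', rfl⟩ : ∃ y₀ y', y = snoc y₀ y' := ⟨_, _, (Fin.snoc_init_self y).symm⟩
  obtain ⟨a, a', rfl⟩ : ∃ a₀ a', a = snoc a₀ a' := ⟨_, _, (Fin.snoc_init_self a).symm⟩
  obtain ⟨b, b', rfl⟩ : ∃ b₀ b', b = snoc b₀ b' := ⟨_, _, (Fin.snoc_init_self b).symm⟩
  have hv0 : ∀ x, 0 ≤ aliceWeight p σ x y a b := fun x => aliceWeight_nonneg hp.1 σ x y a b
  have hw0 := actionWeight_nonneg hp.1 σ (snoc y y') a b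
  rw [aliceWeight_snoc] at h
  rw [observedWeight_snoc, aliceWeight_snoc, actionLaw, sum_actionWeight]
  simp only [snoc, Fin.init_snoc, Fin.snoc_last]
  have hv := left_ne_zero_of_mul h
  have hpn := left_ne_zero_of_mul (right_ne_zero_of_mul h)
  have hind := right_ne_zero_of_mul (right_ne_zero_of_mul h)
  have hV : observedWeight p σ y a b ≠ 0 := by
    have := Finset.single_le_sum (f := fun x => aliceWeight p σ x y a b) (fun x _ => hv0 x)
      (Finset.mem_univ x)
    exact (((hv0 x).lt_of_ne' hv).trans_le this).ne'
  have hPY : ∑ x, p (x, y') ≠ 0 := by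
    have := Finset.single_le_sum (f := fun x => p (x, y')) (fun x _ => hp.1 _)
      (Finset.mem_univ x')
    exact (((hp.1 _).lt_of_ne' hpn).trans_le this).ne'
  have hw : actionWeight p σ (snoc y y') a b a' ≠ 0 := by
    have h1 := Finset.single_le_sum (f := fun x => aliceWeight p σ x (snoc y y') (snoc a a')
      (snoc b b')) (fun x _ => aliceWeight_nonneg hp.1 σ _ _ _ _) (Finset.mem_univ (snoc x x'))
    rw [← observedWeight_snoc p σ y a b y' a' b']
    refine (lt_of_lt_of_le ?_ h1).ne'
    refine (aliceWeight_nonneg hp.1 σ _ _ _ _).lt_of_ne' ?_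
    rw [aliceWeight_snoc]
    exact h
  have hind1 : (if a' = σ T (fun i => (a i, b i)) (snoc x x') then (1 : ℝ) else 0) = 1 := by
    by_contra h1
    exact h1 (if_pos (by by_contra h2; exact hind (if_neg h2)))
  simp only [snoc] at hind1 hw
  -- The chain rule holds play by play. With `v`, `V`, `w` the weights of the source word, of the
  -- observed past and of the past with the new symbol and action, it is `(v p / w) * (w / (V p_Y))
  -- = (v / V) * (p / p_Y)`.
  rw [hind1, mul_one, Real.logb_div (mul_ne_zero hv hpn) hw, Real.logb_mul hv hpn,
    Real.logb_div hw (mul_ne_zero hV hPY), Real.logb_mul hV hPY, Real.logb_div hv hV,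
    Real.logb_div hpn hPY]
  ring

lemma sum_stageEntropy_le (hp : p ∈ stdSimplex ℝ (X × Y)) (σ : AliceStrategy X A B)
    (τ : BobStrategy Y A B) (T : ℕ) :
    ∑ t ∈ Finset.range T, stageEntropy p σ τ t ≤ T * condEntropy p := by
  have h : ∑ t ∈ Finset.range T, stageEntropy p σ τ t + residualEntropy p σ τ T =
      T * condEntropy p := by
    induction T with
    | zero => simp [residualEntropy_zero]
    | succ T ih =>
      rw [Finset.sum_range_succ]
      push_cast
      linarith [residualEntropy_succ_add hp σ τ T]
  linarith [residualEntropy_nonneg hp σ τ T]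

variable [Nonempty B]

/-- Jensen's inequality over Bob's information `z`: `W` is the law of `z` and `L z` the conditional
law of Alice's action. -/
lemma stagePayoff_le (hp : p ∈ stdSimplex ℝ (X × Y)) {u : A → B → ℝ} {σ : AliceStrategy X A B}
    {τ : BobStrategy Y A B}
    (hτ : ∀ (T : ℕ) (y : Fin (T + 1) → Y) (a : Fin T → A) (b : Fin T → B),
      ∑ a', actionLaw p σ y a b a' * ∑ b', (τ T (fun i => (a i, b i)) y).1 b' * u a' b' =
        securityLevel u (actionLaw p σ y a b))
    {g : ℝ → ℝ} (hg : ConcaveOn ℝ (Set.Ici 0) g) (hJ : ∀ s ∈ Set.Ici (0 : ℝ), J u s ≤ g s) (t : ℕ) :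
    0 ≤ stageEntropy p σ τ t ∧ stagePayoff p u σ τ t ≤ g (stageEntropy p σ τ t) := by
  set W : (Fin (t + 1) → Y) × (Fin t → A) × (Fin t → B) → ℝ := fun z =>
    bobWeight τ (Fin.init z.1) z.2.1 z.2.2 * ∑ a', actionWeight p σ z.1 z.2.1 z.2.2 a' with hW
  set L : (Fin (t + 1) → Y) × (Fin t → A) × (Fin t → B) → A → ℝ := fun z =>
    actionLaw p σ z.1 z.2.1 z.2.2 with hL
  have hw0 : ∀ z : (Fin (t + 1) → Y) × (Fin t → A) × (Fin t → B), ∀ a',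
    0 ≤ actionWeight p σ z.1 z.2.1 z.2.2 a' := fun z => actionWeight_nonneg hp.1 σ _ _ _
  have hS0 : ∀ z : (Fin (t + 1) → Y) × (Fin t → A) × (Fin t → B),
    0 ≤ ∑ a', actionWeight p σ z.1 z.2.1 z.2.2 a' := fun z => Finset.sum_nonneg fun a' _ => hw0 z a'
  have hW0 : ∀ z, 0 ≤ W z := fun z => mul_nonneg (bobWeight_nonneg τ _ _ _) (hS0 z)
  have hWL : ∀ z (r : A → ℝ), bobWeight τ (Fin.init z.1) z.2.1 z.2.2 *
      ∑ a', actionWeight p σ z.1 z.2.1 z.2.2 a' * r a' = W z * ∑ a', L z a' * r a' := by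
    intro z r
    simp only [hW, hL]
    rw [mul_assoc]
    congr 1
    rw [Finset.mul_sum]
    refine Finset.sum_congr rfl fun a' _ => ?_
    rw [← mul_assoc]
    congr 1
    -- If the information has weight zero, the division in `actionLaw` is by zero, but both sides
    -- vanish.
    rcases (hS0 z).eq_or_lt with h | h
    · have := (Finset.sum_eq_zero_iff_of_nonneg fun a' _ => hw0 z a').1 h.symm a'
        (Finset.mem_univ _)
      rw [this, ← h, zero_mul]
    · simp only [actionLaw]
      field_simp
  have hL1 : ∀ z, W z ≠ 0 → L z ∈ stdSimplex ℝ A := by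
    intro z hz
    refine ⟨fun a' => div_nonneg (hw0 z a') (hS0 z), ?_⟩
    simp only [hL, actionLaw]
    rw [← Finset.sum_div]
    exact div_self (right_ne_zero_of_mul hz)
  have hLle : ∀ z, 0 ≤ entropy (L z) := fun z =>
    entropy_nonneg (fun a' => div_nonneg (hw0 z a') (hS0 z)) fun a' =>
      div_le_one_of_le₀ (Finset.single_le_sum (f := actionWeight p σ z.1 z.2.1 z.2.2)
        (fun a _ => hw0 z a) (Finset.mem_univ a')) (hS0 z)
  have hsum : ∀ F : (Fin (t + 1) → Y) → (Fin t → A) → (Fin t → B) → A → B → ℝ,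
      expect p σ τ (t + 1) (fun _ y a b =>
        F y (Fin.init a) (Fin.init b) (a (Fin.last t)) (b (Fin.last t))) =
      ∑ z, W z * ∑ a', L z a' *
        ∑ b', (τ t (fun i => (z.2.1 i, z.2.2 i)) z.1).1 b' * F z.1 z.2.1 z.2.2 a' b' := by
    intro F
    rw [expect_succ_eq_sum, Fintype.sum_prod_type]
    refine Finset.sum_congr rfl fun y _ => ?_
    rw [Fintype.sum_prod_type]
    exact Finset.sum_congr rfl fun a _ => Finset.sum_congr rfl fun b _ => hWL (y, a, b) _
  have hW1 : ∑ z, W z = 1 := by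
    have h := hsum fun _ _ _ _ _ => 1
    rw [expect_const hp] at h
    rw [h]
    refine Finset.sum_congr rfl fun z _ => ?_
    by_cases hz : W z = 0
    · simp [hz]
    · simp only [mul_one, (τ _ _ _).2.2, (hL1 z hz).2]
  have hH : stageEntropy p σ τ t = ∑ z, W z * entropy (L z) := by
    rw [stageEntropy, hsum fun y a b a' _ => -Real.logb 2 (actionLaw p σ y a b a')]
    refine Finset.sum_congr rfl fun z _ => ?_
    simp only [← Finset.sum_mul, (τ _ _ _).2.2, one_mul, entropy, neg_mul_eq_mul_neg, hL]
  refine ⟨?_, ?_⟩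
  · rw [hH]
    exact Finset.sum_nonneg fun z _ => mul_nonneg (hW0 z) (hLle z)
  · calc stagePayoff p u σ τ t = ∑ z, W z * securityLevel u (L z) := by
          rw [stagePayoff, hsum fun _ _ _ a' b' => u a' b']
          exact Finset.sum_congr rfl fun z _ => by rw [hτ]
      _ ≤ ∑ z, W z * g (entropy (L z)) := by
          refine Finset.sum_le_sum fun z _ => ?_
          by_cases hz : W z = 0
          · simp [hz]
          · exact mul_le_mul_of_nonneg_left
              ((securityLevel_le_J u (hL1 z hz) le_rfl).trans (hJ _ (hLle z))) (hW0 z)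
      _ ≤ g (∑ z, W z * entropy (L z)) :=
          hg.le_map_sum (fun z _ => hW0 z) hW1 fun z _ => hLle z
      _ = _ := by rw [hH]

lemma condEntropy_nonneg (hp : p ∈ stdSimplex ℝ (X × Y)) : 0 ≤ condEntropy p := by
  refine Finset.sum_nonneg fun x _ => Finset.sum_nonneg fun y _ => neg_nonneg.2 ?_
  have h0 : 0 ≤ ∑ x', p (x', y) := Finset.sum_nonneg fun x' _ => hp.1 _
  exact mul_nonpos_of_nonneg_of_nonpos (hp.1 _) <| Real.logb_nonpos one_lt_two
    (div_nonneg (hp.1 _) h0) (div_le_one_of_le₀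
      (Finset.single_le_sum (f := fun x' => p (x', y)) (fun x' _ => hp.1 _) (Finset.mem_univ x)) h0)

theorem bobCanDefend [Nonempty A] (hp : p ∈ stdSimplex ℝ (X × Y)) (u : A → B → ℝ) :
    BobCanDefend p u (concaveEnvelope (J u) (condEntropy p)) := by
  intro σ
  obtain ⟨τ, hτ⟩ := exists_defence p u σ
  refine ⟨τ, limsup_le_of_le ?_ ?_⟩
  · exact IsBoundedUnder.isCoboundedUnder_le
      ⟨-payoffBound u, eventually_map.2 (Eventually.of_forall fun T =>
        (abs_le.1 (abs_avgPayoff_le hp u σ τ T)).1)⟩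
  filter_upwards [eventually_gt_atTop 0] with T hT
  have hT' : (0 : ℝ) < T := by exact_mod_cast hT
  refine le_concaveEnvelope_J u fun g hg hJ => ?_
  -- The average entropy is only bounded above by `condEntropy p`, so `g` must be monotone.
  have hmono := monotoneOn_of_concaveOn_of_bddBelow hg fun s hs =>
    (neg_payoffBound_le_J u hs).trans (hJ s hs)
  have hstage := stagePayoff_le hp hτ hg hJ
  have hsum : ∑ t ∈ Finset.range T, 1 / (T : ℝ) = 1 := by
    simp [hT'.ne']
  have hJensen := hg.le_map_sum (t := Finset.range T) (w := fun _ => 1 / (T : ℝ))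
    (p := stageEntropy p σ τ) (fun _ _ => by positivity) hsum fun t _ => (hstage t).1
  simp only [smul_eq_mul, ← Finset.mul_sum] at hJensen
  rw [avgPayoff_eq hp]
  calc _ ≤ (1 / (T : ℝ)) * ∑ t ∈ Finset.range T, g (stageEntropy p σ τ t) :=
        mul_le_mul_of_nonneg_left (Finset.sum_le_sum fun t _ => (hstage t).2) (by positivity)
    _ ≤ g ((1 / (T : ℝ)) * ∑ t ∈ Finset.range T, stageEntropy p σ τ t) := hJensen
    _ ≤ g (condEntropy p) := by
        refine hmono ?_ (condEntropy_nonneg hp) ?_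
        · exact mul_nonneg (by positivity) (Finset.sum_nonneg fun t _ => (hstage t).1)
        · rw [one_div, inv_mul_le_iff₀ hT']
          exact sum_stageEntropy_le hp σ τ T

end Defence

/-! ### Alice's strategy -/

section OpenLoop

variable {X Y A B : Type*} [Fintype A] [Fintype B]

/-- A strategy of Alice that ignores the actions played so far. -/
def openLoop (φ : (t : ℕ) → (Fin (t + 1) → X) → A) : AliceStrategy X A B := fun t _ x => φ t x

/-- Alice's actions under an open-loop strategy. -/
def openLoopPlay (φ : (t : ℕ) → (Fin (t + 1) → X) → A) {T : ℕ} (x : Fin T → X) : Fin T → A :=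
  fun t => φ t (upTo x t)

/-- The expected payoff of the last stage, given Alice's actions and the leaked symbols. -/
def lastPayoff (u : A → B → ℝ) (τ : BobStrategy Y A B) {t : ℕ} (y : Fin (t + 1) → Y)
    (a : Fin (t + 1) → A) : ℝ :=
  ∑ b, bobWeight τ y a b * u (a (Fin.last t)) (b (Fin.last t))

lemma abs_lastPayoff_le (u : A → B → ℝ) (τ : BobStrategy Y A B) {t : ℕ} (y : Fin (t + 1) → Y)
    (a : Fin (t + 1) → A) : |lastPayoff u τ y a| ≤ payoffBound u :=
  abs_sum_mul_le ⟨fun b => bobWeight_nonneg τ y a b, sum_bobWeight τ y a⟩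
    fun _ => abs_payoff_le u _ _

/-- Bob's weights up to the last stage do not see Alice's last action, so a fresh draw of it from
`q` guarantees the security level after every past. -/
lemma securityLevel_le_sum_lastPayoff [Nonempty B] (u : A → B → ℝ) (τ : BobStrategy Y A B) {t : ℕ}
    (y : Fin (t + 1) → Y) (a : Fin (t + 1) → A) (q : A → ℝ) :
    securityLevel u q ≤ ∑ c, q c * lastPayoff u τ y (Function.update a (Fin.last t) c) := by
  have h : ∀ c, lastPayoff u τ y (Function.update a (Fin.last t) c) =
      ∑ b : Fin t → B, bobWeight τ (Fin.init y) (Fin.init a) b *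
        ∑ b', (τ t (fun i => (Fin.init a i, b i)) y).1 b' * u c b' := by
    intro c
    rw [lastPayoff, sum_fun_snoc]
    refine Finset.sum_congr rfl fun b _ => ?_
    have h1 : Function.update a (Fin.last t) c = snoc (Fin.init a) c := by
      conv_lhs => rw [← Fin.snoc_init_self a]
      rw [Fin.update_snoc_last]
    have h2 : ∀ b', bobWeight τ y (snoc (Fin.init a) c) (snoc b b') =
        bobWeight τ (Fin.init y) (Fin.init a) b *
          (τ t (fun i => (Fin.init a i, b i)) y).1 b' := by
      intro b'
      conv_lhs => rw [← Fin.snoc_init_self y]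
      rw [bobWeight_snoc]
      simp only [snoc, Fin.snoc_init_self]
    rw [h1, Finset.mul_sum]
    refine Finset.sum_congr rfl fun b' _ => ?_
    rw [h2]
    simp only [snoc, Fin.snoc_last]
    ring
  have h3 : ∑ c, q c * lastPayoff u τ y (Function.update a (Fin.last t) c) =
      ∑ b : Fin t → B, bobWeight τ (Fin.init y) (Fin.init a) b *
        ∑ b', (τ t (fun i => (Fin.init a i, b i)) y).1 b' * ∑ c, q c * u c b' := by
    simp only [h, Finset.mul_sum]
    rw [Finset.sum_comm]
    refine Finset.sum_congr rfl fun b _ => ?_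
    rw [Finset.sum_comm]
    exact Finset.sum_congr rfl fun b' _ => Finset.sum_congr rfl fun c _ => by ring
  rw [h3]
  calc securityLevel u q = ∑ b : Fin t → B, bobWeight τ (Fin.init y) (Fin.init a) b *
        ∑ b', (τ t (fun i => (Fin.init a i, b i)) y).1 b' * securityLevel u q := by
        simp only [← Finset.sum_mul, (τ _ _ _).2.2, one_mul]
        rw [sum_bobWeight, one_mul]
    _ ≤ _ := by
        refine Finset.sum_le_sum fun b _ => mul_le_mul_of_nonneg_left ?_ (bobWeight_nonneg τ _ _ _)
        exact Finset.sum_le_sum fun b' _ =>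
          mul_le_mul_of_nonneg_left (securityLevel_le u q b') ((τ _ _ _).2.1 _)

variable [Fintype X] [Fintype Y] [DecidableEq A]

lemma stagePayoff_openLoop (p : X × Y → ℝ) (u : A → B → ℝ)
    (φ : (t : ℕ) → (Fin (t + 1) → X) → A) (τ : BobStrategy Y A B) (t : ℕ) :
    stagePayoff p u (openLoop φ) τ t = ∑ z : Fin (t + 1) → X × Y, (∏ i, p (z i)) *
      lastPayoff u τ (fun i => (z i).2) (openLoopPlay φ fun i => (z i).1) := by
  rw [sum_fun_prod, Finset.sum_comm, stagePayoff, expect]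
  refine Finset.sum_congr rfl fun x _ => Finset.sum_congr rfl fun y _ => ?_
  have h : ∀ (a : Fin (t + 1) → A) (b : Fin (t + 1) → B), aliceWeight p (openLoop φ) x y a b =
      (∏ i, p (x i, y i)) * (if a = openLoopPlay φ x then 1 else 0) := by
    intro a b
    rw [aliceWeight, Finset.prod_mul_distrib]
    congr 1
    split_ifs with ha
    · subst ha
      exact Finset.prod_eq_one fun s _ => if_pos rfl
    · obtain ⟨s, hs⟩ := Function.ne_iff.1 ha
      exact Finset.prod_eq_zero (Finset.mem_univ s) (if_neg hs)
  simp only [playProb_eq_mul, h]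
  rw [Finset.sum_eq_single (openLoopPlay φ x)]
  · simp only [if_true, mul_one, lastPayoff, Finset.mul_sum, mul_assoc]
  · intro a _ ha
    simp [ha]
  · simp

/-- If from stage `s₀` on Alice plays the sequence `f x` that she extracts from earlier source
symbols `x`, she gets at each stage almost the security level of the target law. -/
lemma securityLevel_sub_le_stagePayoff [Nonempty B] {p : X × Y → ℝ}
    (hp : p ∈ stdSimplex ℝ (X × Y)) (u : A → B → ℝ) {φ : (t : ℕ) → (Fin (t + 1) → X) → A}
    (τ : BobStrategy Y A B) {t s₀ n m : ℕ} (hs₀ : s₀ ≤ t) (ht : t < s₀ + m)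
    {e : Fin n → Fin (t + 1)} (he : Function.Injective e) (f : (Fin n → X) → Fin m → A)
    {q : Fin m → A → ℝ} (hq : ∀ i, q i ∈ stdSimplex ℝ A)
    (hnew : ∀ (x : Fin (t + 1) → X) (s : Fin (t + 1)) (hs : s₀ ≤ (s : ℕ)),
      openLoopPlay φ x s = f (x ∘ e) ⟨s - s₀, by omega⟩)
    (hold : ∀ x x' : Fin (t + 1) → X, (∀ s, (¬∃ j, e j = s) → x s = x' s) →
      ∀ s : Fin (t + 1), (s : ℕ) < s₀ → openLoopPlay φ x s = openLoopPlay φ x' s) :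
    securityLevel u (q ⟨t - s₀, by omega⟩) - payoffBound u * extractionError p q f ≤
      stagePayoff p u (openLoop φ) τ t := by
  classical
  set S := securityLevel u (q ⟨t - s₀, by omega⟩) with hS
  rw [stagePayoff_openLoop, sum_prod_weight_resample (w := fun _ => p) (fun _ => hp.2) he]
  have hz : ∀ z : Fin (t + 1) → X × Y, S - payoffBound u * extractionError p q f ≤
      ∑ v : Fin n → X × Y, (∏ j, p (v j)) *
        lastPayoff u τ (fun i => (Function.extend e v z i).2)
          (openLoopPlay φ fun i => (Function.extend e v z i).1) := by
    intro z
    -- With the symbols outside the source block frozen at `z`, the earlier actions are fixed by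
    -- `hold` and only the extracted word `a` varies.
    set h : (Fin m → A) → Fin (t + 1) → A := fun a s =>
      if hs : s₀ ≤ (s : ℕ) then a ⟨s - s₀, by omega⟩ else openLoopPlay φ (fun i => (z i).1) s with hh
    set G : (Fin n → Y) → (Fin m → A) → ℝ := fun y a =>
      lastPayoff u τ (Function.extend e y fun i => (z i).2) (h a) with hG
    have h1 : ∀ v : Fin n → X × Y, lastPayoff u τ (fun i => (Function.extend e v z i).2)
          (openLoopPlay φ fun i => (Function.extend e v z i).1) =
        G (fun j => (v j).2) (f fun j => (v j).1) := by
      intro v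
      simp only [hG]
      congr 1
      · funext i
        exact Function.apply_extend Prod.snd e z i
      · funext s
        simp only [hh]
        split_ifs with hs
        · rw [hnew _ s hs]
          congr 2
          funext j
          simp [he.extend_apply]
        · refine hold _ _ (fun s hs => ?_) s (not_le.1 hs)
          rw [Function.extend_apply' _ _ _ hs]
    have hGabs : ∀ y a, |G y a| ≤ payoffBound u := fun y a => abs_lastPayoff_le u τ _ _
    have hlast : ∀ a c, h (Function.update a ⟨t - s₀, by omega⟩ c) =
        Function.update (h a) (Fin.last t) c := by
      intro a c
      funext s
      by_cases hs : s = Fin.last t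
      · subst hs
        simp [hh, hs₀]
      · rw [Function.update_of_ne hs]
        simp only [hh]
        split_ifs with hs1
        · refine Function.update_of_ne ?_ _ _
          intro h2
          rw [Fin.mk.injEq] at h2
          exact hs (Fin.ext (by simp only [Fin.val_last]; omega))
        · rfl
    -- Under the ideal product law the action of stage `t` is independent of the rest of the word,
    -- so Bob gains nothing from the past.
    have hideal : ∀ y, S ≤ ∑ a : Fin m → A, (∏ j, q j (a j)) * G y a := by
      intro y
      rw [sum_prod_weight_update (fun i => (hq i).2) (⟨t - s₀, by omega⟩ : Fin m)]
      calc S = ∑ a : Fin m → A, (∏ j, q j (a j)) * S := by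
            rw [← Finset.sum_mul, sum_prod_weight fun i => (hq i).2, one_mul]
        _ ≤ _ := by
            refine Finset.sum_le_sum fun a _ => mul_le_mul_of_nonneg_left ?_
              (Finset.prod_nonneg fun i _ => (hq i).1 _)
            simp only [hG, hlast]
            exact securityLevel_le_sum_lastPayoff u τ _ _ _
    set R : (Fin n → Y) → (Fin m → A) → ℝ := fun y a =>
      ∑ x : Fin n → X, (∏ i, p (x i, y i)) * (if f x = a then 1 else 0) with hR
    set D : (Fin n → Y) → (Fin m → A) → ℝ := fun y a =>
      (∑ x : Fin n → X, ∏ i, p (x i, y i)) * ∏ j, q j (a j) with hD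
    have h2 : ∑ v : Fin n → X × Y, (∏ j, p (v j)) *
        lastPayoff u τ (fun i => (Function.extend e v z i).2)
          (openLoopPlay φ fun i => (Function.extend e v z i).1) =
        ∑ y, ∑ a, R y a * G y a := by
      simp only [h1]
      rw [sum_fun_prod]
      refine Finset.sum_congr rfl fun y _ => ?_
      simp only [hR, Finset.sum_mul]
      rw [Finset.sum_comm]
      refine Finset.sum_congr rfl fun x _ => ?_
      simp
    have h3 : S ≤ ∑ y, ∑ a, D y a * G y a := by
      have hY : ∑ y : Fin n → Y, ∑ x : Fin n → X, ∏ i, p (x i, y i) = 1 := by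
        rw [← sum_fun_prod fun z => ∏ i, p (z i)]
        exact sum_prod_weight (w := fun _ => p) fun _ => hp.2
      calc S = ∑ y : Fin n → Y, (∑ x : Fin n → X, ∏ i, p (x i, y i)) * S := by
            rw [← Finset.sum_mul, hY, one_mul]
        _ ≤ ∑ y : Fin n → Y, (∑ x : Fin n → X, ∏ i, p (x i, y i)) *
            ∑ a : Fin m → A, (∏ j, q j (a j)) * G y a :=
            Finset.sum_le_sum fun y _ => mul_le_mul_of_nonneg_left (hideal y)
              (Finset.sum_nonneg fun x _ => Finset.prod_nonneg fun i _ => hp.1 _)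
        _ = _ := by simp only [hD, Finset.mul_sum, mul_assoc]
    have h4 : ∑ y, ∑ a, D y a * G y a - ∑ y, ∑ a, R y a * G y a ≤
        payoffBound u * extractionError p q f := by
      rw [extractionError, Finset.mul_sum, ← Finset.sum_sub_distrib]
      refine Finset.sum_le_sum fun y _ => ?_
      rw [Finset.mul_sum, ← Finset.sum_sub_distrib]
      refine Finset.sum_le_sum fun a _ => ?_
      calc D y a * G y a - R y a * G y a ≤ |(R y a - D y a) * G y a| := by
            rw [← sub_mul, ← abs_neg]
            refine (le_abs_self _).trans (le_of_eq ?_)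
            congr 1
            ring
        _ ≤ _ := by
            rw [abs_mul, mul_comm]
            exact mul_le_mul_of_nonneg_right (hGabs y a) (abs_nonneg _)
    rw [h2]
    linarith
  calc _ = ∑ z : Fin (t + 1) → X × Y, (∏ i, p (z i)) *
        (S - payoffBound u * extractionError p q f) := by
        rw [← Finset.sum_mul, sum_prod_weight (w := fun _ => p) fun _ => hp.2, one_mul]
    _ ≤ _ := Finset.sum_le_sum fun z _ =>
        mul_le_mul_of_nonneg_left (hz z) (Finset.prod_nonneg fun i _ => hp.1 _)

end OpenLoop

/-- Lower bounds on the averages over the blocks `[(k+1)², (k+2)²)` bound the Cesàro averages. -/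
lemma eventually_le_average {M c : ℝ} {s : ℕ → ℝ} (hs : ∀ᶠ k in atTop, c < s k) {c' : ℝ}
    (hc' : c' < c) :
    ∀ᶠ T : ℕ in atTop, ∀ r : ℕ → ℝ, (∀ t, |r t| ≤ M) →
      (∀ k, (2 * k + 1 + 2 : ℕ) * s k ≤ ∑ i ∈ Finset.range (2 * k + 1 + 2), r ((k + 1) ^ 2 + i)) →
        c' ≤ (1 / (T : ℝ)) * ∑ t ∈ Finset.range T, r t := by
  obtain ⟨k₀, hk₀⟩ := eventually_atTop.1 hs
  set D : ℝ := ((k₀ + 1) ^ 2 : ℕ) * (M + |c|) with hD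
  -- `D` pays for the stages before the bound on the blocks takes effect; the last term pays for the
  -- unfinished block, of at most `2 * √T` stages.
  have hlim : Tendsto (fun T : ℕ => c - D / T - 2 * (M + |c|) / √(T : ℝ)) atTop
      (nhds (c - 0 - 0)) := by
    refine (tendsto_const_nhds.sub (tendsto_const_div_atTop_nhds_zero_nat D)).sub ?_
    exact tendsto_const_nhds.div_atTop (Real.tendsto_sqrt_atTop.comp tendsto_natCast_atTop_atTop)
  rw [sub_zero, sub_zero] at hlim
  filter_upwards [hlim.eventually_const_le hc', eventually_ge_atTop ((k₀ + 1) ^ 2)] with T hT hTk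
    r hr hblock
  refine hT.trans ?_
  have hT0 : 0 < T := lt_of_lt_of_le (by positivity) hTk
  have hT' : (0 : ℝ) < T := by exact_mod_cast hT0
  have hlow : ∀ t, -(M + |c|) ≤ r t - c := fun t => by
    linarith [(abs_le.1 (hr t)).1, le_abs_self c]
  have hlow' : ∀ (n l : ℕ), -(l * (M + |c|)) ≤ ∑ i ∈ Finset.range l, (r (n + i) - c) := by
    intro n l
    refine le_trans (le_of_eq ?_) (Finset.sum_le_sum fun i _ => hlow (n + i))
    simp
    ring
  have hMc : 0 ≤ M + |c| := by
    linarith [(abs_nonneg (r 0)).trans (hr 0), abs_nonneg c]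
  have hsq : ∀ K, k₀ ≤ K → -D ≤ ∑ t ∈ Finset.range ((K + 1) ^ 2), (r t - c) := by
    intro K hK
    induction K, hK using Nat.le_induction with
    | base =>
      have h := hlow' 0 ((k₀ + 1) ^ 2)
      simpa only [Nat.zero_add] using h
    | succ K hK ih =>
      rw [show (K + 1 + 1) ^ 2 = (K + 1) ^ 2 + (2 * K + 1 + 2) by ring, Finset.sum_range_add,
        Finset.sum_sub_distrib (f := fun i => r ((K + 1) ^ 2 + i))]
      have h1 := hblock K
      have h2 : ((2 * K + 1 + 2 : ℕ) : ℝ) * c ≤ (2 * K + 1 + 2 : ℕ) * s K :=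
        mul_le_mul_of_nonneg_left (hk₀ K hK).le (Nat.cast_nonneg _)
      simp only [Finset.sum_const, Finset.card_range, nsmul_eq_mul]
      linarith
  obtain ⟨K, hK⟩ : ∃ K, Nat.sqrt T = K + 1 := Nat.exists_eq_succ_of_ne_zero
    (Nat.sqrt_pos.2 hT0).ne'
  have hk₀K : k₀ ≤ K := by
    have := Nat.sqrt_le_sqrt hTk
    rw [Nat.sqrt_eq', hK] at this
    omega
  have h1 : (K + 1) ^ 2 ≤ T := hK ▸ Nat.sqrt_le' T
  have h2 : T < (K + 1 + 1) ^ 2 := hK ▸ Nat.lt_succ_sqrt' T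
  obtain ⟨l, rfl⟩ := Nat.exists_eq_add_of_le h1
  have hl : l ≤ 2 * (K + 1) := by nlinarith
  set T := (K + 1) ^ 2 + l with hTdef
  have h3 : -D - 2 * (K + 1) * (M + |c|) ≤ ∑ t ∈ Finset.range T, (r t - c) := by
    rw [hTdef, Finset.sum_range_add]
    have h4 := hsq K hk₀K
    have h5 := hlow' ((K + 1) ^ 2) l
    have h6 : (l : ℝ) ≤ 2 * (K + 1) := by exact_mod_cast hl
    nlinarith
  rw [Finset.sum_sub_distrib, Finset.sum_const, Finset.card_range, nsmul_eq_mul] at h3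
  have h7 : (K : ℝ) + 1 ≤ √(T : ℝ) := by
    have := Real.nat_sqrt_le_real_sqrt (a := T)
    rw [hK] at this
    exact_mod_cast this
  have h8 : 2 * (M + |c|) / √(T : ℝ) * T = 2 * (M + |c|) * √(T : ℝ) := by
    rw [div_mul_eq_mul_div, div_eq_iff (Real.sqrt_pos.2 hT').ne', mul_assoc _ (√(T : ℝ)),
      Real.mul_self_sqrt hT'.le]
  rw [one_div, le_inv_mul_iff₀ hT', mul_comm, sub_mul, sub_mul, div_mul_cancel₀ _ hT'.ne', h8]
  nlinarith

/-- Nearly maximizing a score at each index attains every bound that can be attained. -/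
lemma exists_seq_eventually_lt {Z : ℕ → Type*} [∀ k, Nonempty (Z k)] (score : ∀ k, Z k → ℝ) {M : ℝ}
    (hM : ∀ k z, score k z ≤ M) :
    ∃ z : ∀ k, Z k, ∀ c, (∀ c' < c, ∀ᶠ k in atTop, ∃ z : Z k, c' < score k z) →
      ∀ c' < c, ∀ᶠ k in atTop, c' < score k (z k) := by
  have hex : ∀ k : ℕ, ∃ z : Z k, (⨆ z, score k z) - 1 / ((k : ℝ) + 1) < score k z := fun k =>
    exists_lt_of_lt_ciSup (sub_lt_self _ (by positivity))
  choose z hz using hex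
  refine ⟨z, fun c hc c' hc' => ?_⟩
  obtain ⟨d, hd, hdc⟩ := exists_between hc'
  filter_upwards [hc d hdc, (tendsto_one_div_add_atTop_nhds_zero_nat (𝕜 := ℝ)).eventually_lt_const
    (sub_pos.2 hd)] with k ⟨z', hz'⟩ hk
  have := le_ciSup ⟨M, by rintro _ ⟨z, rfl⟩; exact hM k z⟩ z' (f := score k)
  linarith [hz k]

/-! ### Extraction in one block, play in the next -/

section Blocks

variable {X Y A B : Type*}

/-- Alice's open-loop strategy that plays, in the block `[(k+1)², (k+2)²)`, the sequence that `f k`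
extracts from the source symbols of the block `[k², (k+1)²)`. -/
def blockPlay [Nonempty A] (f : ∀ k : ℕ, (Fin (2 * k + 1) → X) → Fin (2 * k + 1 + 2) → A) (t : ℕ)
    (x : Fin (t + 1) → X) : A :=
  -- For `t ≠ 0` the second condition always holds and the `min` below is inactive; both only keep
  -- indices in range. The arbitrary action occurs at stage `0` alone.
  if h : t ≠ 0 ∧ t - t.sqrt ^ 2 < 2 * (t.sqrt - 1) + 1 + 2 then
    f (t.sqrt - 1) (fun j => x ⟨min ((t.sqrt - 1) ^ 2 + j) t, by omega⟩) ⟨t - t.sqrt ^ 2, h.2⟩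
  else Classical.arbitrary A

lemma blockPlay_eq [Nonempty A] (f : ∀ k : ℕ, (Fin (2 * k + 1) → X) → Fin (2 * k + 1 + 2) → A)
    {t k : ℕ} (hk : t.sqrt = k + 1) (x : Fin (t + 1) → X) (ht : t - (k + 1) ^ 2 < 2 * k + 1 + 2) :
    blockPlay f t x =
      f k (fun j => x ⟨min (k ^ 2 + j) t, by omega⟩) ⟨t - (k + 1) ^ 2, ht⟩ := by
  have ht0 : t ≠ 0 := by
    rintro rfl
    simp at hk
  -- The type of `f (t.sqrt - 1)` depends on `t.sqrt`, so the root is generalised before it is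
  -- replaced.
  have hgen : ∀ (s : ℕ) (hs : s = k + 1) (h : t - s ^ 2 < 2 * (s - 1) + 1 + 2),
      f (s - 1) (fun j => x ⟨min ((s - 1) ^ 2 + j) t, by omega⟩) ⟨t - s ^ 2, h⟩ =
        f k (fun j => x ⟨min (k ^ 2 + j) t, by omega⟩) ⟨t - (k + 1) ^ 2, ht⟩ := by
    rintro s rfl h
    rfl
  have hlt : t - t.sqrt ^ 2 < 2 * (t.sqrt - 1) + 1 + 2 := by
    rw [hk]
    exact ht
  rw [blockPlay, dif_pos ⟨ht0, hlt⟩]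
  exact hgen _ hk hlt

variable [Fintype X] [Fintype Y] [Fintype A] [Fintype B] [DecidableEq A] [Nonempty B]

lemma securityLevel_sub_le_stagePayoff_blockPlay [Nonempty A] {p : X × Y → ℝ} (hp : p ∈ stdSimplex ℝ (X × Y))
    (u : A → B → ℝ) (f : ∀ k : ℕ, (Fin (2 * k + 1) → X) → Fin (2 * k + 1 + 2) → A)
    (τ : BobStrategy Y A B) (k : ℕ) {q : Fin (2 * k + 1 + 2) → A → ℝ}
    (hq : ∀ i, q i ∈ stdSimplex ℝ A) (i : Fin (2 * k + 1 + 2)) :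
    securityLevel u (q i) - payoffBound u * extractionError p q (f k) ≤
      stagePayoff p u (openLoop (blockPlay f)) τ ((k + 1) ^ 2 + i) := by
  have hsqrt : ∀ s, (k + 1) ^ 2 ≤ s → s ≤ (k + 1) ^ 2 + i → Nat.sqrt s = k + 1 := by
    intro s h1 h2
    have := i.is_lt
    exact Nat.eq_sqrt'.2 ⟨h1, by nlinarith⟩ |>.symm
  have hkk : (k + 1) ^ 2 = k ^ 2 + (2 * k + 1) := by ring
  have hmain := securityLevel_sub_le_stagePayoff hp u (φ := blockPlay f) τ
    (t := (k + 1) ^ 2 + i) (s₀ := (k + 1) ^ 2) (n := 2 * k + 1) (m := 2 * k + 1 + 2)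
    (Nat.le_add_right _ _) (by omega)
    (e := fun j => ⟨k ^ 2 + j, by omega⟩)
    (fun j j' h => Fin.ext (by simpa using h)) (f k) hq ?_ ?_
  · simpa using hmain
  · intro x s hs
    have hs' := s.is_lt
    rw [openLoopPlay, blockPlay_eq f (hsqrt s hs (by omega)) _ (by omega)]
    congr 1
    funext j
    simp only [upTo, Function.comp_apply]
    congr 1
    refine Fin.ext ?_
    simp only [Fin.val_castLE]
    omega
  -- Actions before stage `(k + 1) ^ 2` read only symbols before `k ^ 2`, hence none of the block
  -- now used for extraction.
  · intro x x' hx s hs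
    rcases Nat.eq_zero_or_pos (Nat.sqrt s) with h0 | h0
    · have : (s : ℕ) = 0 := Nat.sqrt_eq_zero.1 h0
      simp [openLoopPlay, blockPlay, this]
    · obtain ⟨k', hk'⟩ := Nat.exists_eq_succ_of_ne_zero h0.ne'
      have h1 : Nat.sqrt s < k + 1 := Nat.sqrt_lt'.2 hs
      have h2 : (s : ℕ) < (k' + 1 + 1) ^ 2 := by
        have := Nat.lt_succ_sqrt' (s : ℕ)
        rwa [hk'] at this
      have h3 : (s : ℕ) - (k' + 1) ^ 2 < 2 * k' + 1 + 2 := by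
        rw [show (k' + 1 + 1) ^ 2 = (k' + 1) ^ 2 + (2 * k' + 1 + 2) by ring] at h2
        omega
      rw [openLoopPlay, openLoopPlay, blockPlay_eq f hk' _ h3, blockPlay_eq f hk' _ h3]
      congr 1
      funext j
      refine hx _ ?_
      rintro ⟨j', hj'⟩
      rw [Fin.ext_iff] at hj'
      simp only [Fin.val_castLE] at hj'
      have h4 : (k' + 1) ^ 2 ≤ k ^ 2 := Nat.pow_le_pow_left (by omega) 2
      have h5 : (k' + 1) ^ 2 = k' ^ 2 + (2 * k' + 1) := by ring
      omega

/-- The candidates for a block: target laws and a map that extracts actions from the source. -/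
abbrev BlockPlan (X A : Type*) [Fintype A] (k : ℕ) :=
  (Fin (2 * k + 1 + 2) → stdSimplex ℝ A) × ((Fin (2 * k + 1) → X) → Fin (2 * k + 1 + 2) → A)

/-- The average payoff that a plan guarantees over its block. -/
def planScore (p : X × Y → ℝ) (u : A → B → ℝ) (k : ℕ) (z : BlockPlan X A k) : ℝ :=
  (∑ i, securityLevel u (z.1 i).1) / (2 * k + 1 + 2 : ℕ) -
    payoffBound u * extractionError p (fun i => (z.1 i).1) z.2

lemma planScore_le (p : X × Y → ℝ) (u : A → B → ℝ) (k : ℕ) (z : BlockPlan X A k) :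
    planScore p u k z ≤ payoffBound u := by
  have h1 : (∑ i, securityLevel u (z.1 i).1) / (2 * k + 1 + 2 : ℕ) ≤ payoffBound u := by
    rw [div_le_iff₀ (by positivity), mul_comm (payoffBound u)]
    refine (Finset.sum_le_sum fun i _ =>
      (abs_le.1 (abs_securityLevel_le u (z.1 i).2)).2).trans (le_of_eq ?_)
    simp
  have h2 := mul_nonneg (payoffBound_nonneg u)
    (extractionError_nonneg p (fun i => (z.1 i).1) z.2)
  rw [planScore]
  linarith

variable [Nonempty A]

lemma mul_planScore_le_sum_stagePayoff {p : X × Y → ℝ} (hp : p ∈ stdSimplex ℝ (X × Y))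
    (u : A → B → ℝ) (z : ∀ k, BlockPlan X A k) (τ : BobStrategy Y A B) (k : ℕ) :
    (2 * k + 1 + 2 : ℕ) * planScore p u k (z k) ≤ ∑ i ∈ Finset.range (2 * k + 1 + 2),
      stagePayoff p u (openLoop (blockPlay fun k => (z k).2)) τ ((k + 1) ^ 2 + i) := by
  rw [Finset.sum_range, planScore, mul_sub, mul_div_cancel₀ _ (by positivity)]
  calc _ = ∑ i, (securityLevel u ((z k).1 i).1 -
        payoffBound u * extractionError p (fun i => ((z k).1 i).1) (z k).2) := by
        simp [Finset.sum_sub_distrib]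
    _ ≤ _ := Finset.sum_le_sum fun i _ =>
        securityLevel_sub_le_stagePayoff_blockPlay hp u (fun k => (z k).2) τ k
          (fun i => ((z k).1 i).2) i

lemma extractionError_const {X Y A : Type*} [Fintype X] [Fintype Y] [Fintype A]
    [DecidableEq A] {p : X × Y → ℝ} (a : A) {n m : ℕ} :
    extractionError p (fun _ : Fin m => Pi.single a (1 : ℝ)) (fun _ : Fin n → X => fun _ => a) =
      0 := by
  refine Finset.sum_eq_zero fun y _ => Finset.sum_eq_zero fun c _ => ?_
  rw [← Finset.sum_mul, ← mul_sub, abs_eq_zero]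
  refine mul_eq_zero_of_right _ (sub_eq_zero.2 ?_)
  split_ifs with h
  · subst h
    simp
  · obtain ⟨j, hj⟩ := Function.ne_iff.1 h
    exact (Finset.prod_eq_zero (Finset.mem_univ j) (Pi.single_eq_of_ne (Ne.symm hj) _)).symm

lemma eventually_exists_lt_planScore {p : X × Y → ℝ} (hp : p ∈ stdSimplex ℝ (X × Y))
    (u : A → B → ℝ) {c : ℝ} (hc : c < concaveEnvelope (J u) (condEntropy p)) :
    ∀ᶠ k in atTop, ∃ z : BlockPlan X A k, c < planScore p u k z := by
  rcases (condEntropy_nonneg hp).eq_or_lt with h0 | h0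
  -- No rate lies strictly below a zero source entropy, so a constant pure action replaces the
  -- extraction, without error.
  · rw [← h0] at hc
    obtain ⟨q, hq, hq0⟩ := exists_mem_stdSimplex_entropy_le (A := A) le_rfl
    have hne : (securityLevel u '' {q | q ∈ stdSimplex ℝ A ∧ entropy q ≤ 0}).Nonempty :=
      ⟨_, q, ⟨hq, hq0⟩, rfl⟩
    obtain ⟨_, ⟨q, ⟨hq, hq0⟩, rfl⟩, hlt⟩ := exists_lt_of_lt_csSup hne
      (hc.trans_le (concaveEnvelope_J_zero_le u))
    obtain ⟨a, rfl⟩ := eq_single_of_entropy_le_zero hq hq0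
    refine Eventually.of_forall fun k => ⟨⟨fun _ => ⟨_, hq⟩, fun _ _ => a⟩, ?_⟩
    simp only [planScore]
    rw [extractionError_const, mul_zero, sub_zero, Finset.sum_const, Finset.card_univ,
      Fintype.card_fin, nsmul_eq_mul, mul_div_cancel_left₀ _ (by positivity)]
    exact hlt
  · obtain ⟨c', hcc', hc'⟩ := exists_between hc
    obtain ⟨h, hh, q, hq, C, hC⟩ := exists_achievable_of_lt_concaveEnvelope u h0 hc'
    set M := payoffBound u with hM
    have hM0 : 0 ≤ M := payoffBound_nonneg u
    -- Half of the slack `c' - c` covers the extraction error, the other half the bounded error `C`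
    -- of time sharing.
    set ε := (c' - c) / 2 / (M + 1) with hε
    have hε0 : 0 < ε := div_pos (by linarith) (by linarith)
    have hMε : M * ε ≤ (c' - c) / 2 := by
      have : (M + 1) * ε = (c' - c) / 2 := by rw [hε]; field_simp
      nlinarith
    have htop : Tendsto (fun k : ℕ => 2 * k + 1) atTop atTop :=
      tendsto_atTop_mono (fun k => by simp only [id]; omega) tendsto_id
    have htop' : Tendsto (fun k : ℕ => 2 * k + 1 + 2) atTop atTop :=
      tendsto_atTop_mono (fun k => by simp only [id]; omega) tendsto_id
    filter_upwards [htop.eventually (eventually_exists_extractionError_le hp hq hh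
      (fun n => (hC n).1) hε0), htop'.eventually
      ((tendsto_const_div_atTop_nhds_zero_nat C).eventually_lt_const
        (show 0 < (c' - c) / 2 by linarith))] with k ⟨f, hf⟩ hk
    refine ⟨⟨fun i => ⟨q i, hq i⟩, f⟩, ?_⟩
    have h1 := (hC (2 * k + 1 + 2)).2
    rw [Finset.sum_range] at h1
    have hn : (0 : ℝ) < (2 * k + 1 + 2 : ℕ) := by positivity
    have h2 : c' - C / (2 * k + 1 + 2 : ℕ) ≤
        (∑ i : Fin (2 * k + 1 + 2), securityLevel u (q i)) / (2 * k + 1 + 2 : ℕ) := by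
      rw [le_div_iff₀ hn, sub_mul, div_mul_cancel₀ _ hn.ne', mul_comm c']
      exact h1
    have h3 : M * extractionError p (fun i : Fin (2 * k + 1 + 2) => q i) f ≤ M * ε :=
      mul_le_mul_of_nonneg_left hf hM0
    simp only [planScore]
    linarith

theorem aliceCanSecure {p : X × Y → ℝ} (hp : p ∈ stdSimplex ℝ (X × Y)) (u : A → B → ℝ) :
    AliceCanSecure p u (concaveEnvelope (J u) (condEntropy p)) := by
  obtain ⟨q₀, hq₀, -⟩ := exists_mem_stdSimplex_entropy_le (A := A) le_rfl
  have : ∀ k, Nonempty (BlockPlan X A k) := fun k =>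
    ⟨⟨fun _ => ⟨q₀, hq₀⟩, fun _ _ => Classical.arbitrary A⟩⟩
  -- The plans are fixed before `c` and `τ`, so one strategy serves all bounds below the envelope.
  obtain ⟨z, hz⟩ := exists_seq_eventually_lt (Z := BlockPlan X A)
    (fun k z => planScore p u k z) (planScore_le p u)
  refine ⟨openLoop (blockPlay fun k => (z k).2), fun τ => le_of_forall_lt fun c hc => ?_⟩
  obtain ⟨c₁, hc₁, hc₁'⟩ := exists_between hc
  obtain ⟨c₂, hc₂, hc₂'⟩ := exists_between hc₁'
  refine hc₁.trans_le (le_liminf_of_le ?_ ?_)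
  · exact IsBoundedUnder.isCoboundedUnder_ge
      ⟨payoffBound u, eventually_map.2 (Eventually.of_forall fun T =>
        (abs_le.1 (abs_avgPayoff_le hp u _ τ T)).2)⟩
  filter_upwards [eventually_le_average (M := payoffBound u)
    (hz _ (fun c' hc' => eventually_exists_lt_planScore hp u hc') c₂ hc₂') hc₂] with T hT
  rw [avgPayoff_eq hp]
  exact hT _ (fun t => abs_stagePayoff_le hp u _ τ t)
    (mul_planScore_le_sum_stagePayoff hp u z τ)

end Blocks

end

end LeakedGame

theorem theoremT {X Y A B : Type*} [Fintype X] [Fintype Y]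
    [Fintype A] [DecidableEq A] [Nonempty A] [Fintype B] [Nonempty B]
    (p : X × Y → ℝ) (hp : p ∈ stdSimplex ℝ (X × Y)) (u : A → B → ℝ) :
    LeakedGame.IsMaxminValue p u
      (LeakedGame.concaveEnvelope (LeakedGame.J u) (LeakedGame.condEntropy p)) :=
  ⟨LeakedGame.aliceCanSecure hp u, LeakedGame.bobCanDefend hp u⟩
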